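/- Let $n\ge 1$, let $\Omega\subset\mathbb{R}^n$ be a bounded domain (a non-empty, bounded, connected open set), let $2\le p<\infty$ and let $\alpha$ satisfy $n<\alpha p<n+p$. Put $s=\alpha-\frac np\in(0,1)$. Let $W^{s,p}(\Omega)$ be the space of measurable functions $u$ on $\Omega$ with finite norm $$\|u\|_{W^{s,p}(\Omega)}=\left(\int_\Omega\int_\Omega\frac{|u(y)-u(x)|^p}{|y-x|^{n+sp}}\,dx\,dy+\int_\Omega|u|^p\,dx\right)^{1/p},$$ and let $W^{s,p}_0(\Omega)$ be the closure of $C_0^\infty(\Omega)$ in $W^{s,p}(\Omega)$; its elements are extended by zero to $\mathbb{R}^n$. For a function $u\not\equiv0$ in $W_0^{s,p}(\Omega)$ define the fractional Rayleigh quotient $$\mathcal{R}(u)=\frac{\displaystyle\int_{\mathbb{R}^n}\int_{\mathbb{R}^n}\frac{|u(y)-u(x)|^p}{|y-x|^{\alpha p}}\,dx\,dy}{\displaystyle\int_{\mathbb{R}^n}|u(x)|^p\,dx}\in[0,\infty],$$ and let $\lambda_1=\inf\{\mathcal{R}(\phi):\phi\in C_0^\infty(\Omega),\ \phi\not\equiv0\}$.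 A minimizer is a function $u\in W^{s,p}_0(\Omega)$, $u\not\equiv0$, such that $\mathcal{R}(u)\le\mathcal{R}(v)$ for all $v\in W^{s,p}_0(\Omega)$, $v\not\equiv0$. Then $\lambda_1<\infty$, and there exists a non-negative minimizer $u$, with $u=0$ in $\mathbb{R}^n\setminus\Omega$. Moreover, every minimizer $u$ satisfies $\mathcal{R}(u)=\lambda_1$ and the weak Euler–Lagrange equation $$\int_{\mathbb{R}^n}\int_{\mathbb{R}^n}\frac{|u(y)-u(x)|^{p-2}\bigl(u(y)-u(x)\bigr)\bigl(\phi(y)-\phi(x)\bigr)}{|y-x|^{\alpha p}}\,dx\,dy=\lambda_1\int_{\mathbb{R}^n}|u|^{p-2}u\,\phi\,dx\qquad\text{for all }\phi\in C_0^\infty(\Omega),$$ where the integrals on both sides converge absolutely. If in addition $\alpha p>2n$, then every minimizer agrees almost everywhere with a function that vanishes in $\mathbb{R}^n\setminus\Omega$ and belongs to $C^{0,\beta}(\mathbb{R}^n)$ (it is bounded and Hölder continuous with exponent $\beta$), where $\beta=\alpha-\frac{2n}{p}$. -/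

import Mathlib

open MeasureTheory
open scoped ENNReal ContDiff

noncomputable section

/-- Test functions: `φ ∈ C₀^∞(D)`, i.e. `φ` is smooth with compact support contained in `D`. -/
def IsTestFunction {n : ℕ} (D : Set (EuclideanSpace ℝ (Fin n)))
    (φ : EuclideanSpace ℝ (Fin n) → ℝ) : Prop :=
  ContDiff ℝ ∞ φ ∧ HasCompactSupport φ ∧ tsupport φ ⊆ D

/-- The double integral `∫_D ∫_D |u(y) - u(x)|^p / |y - x|^q dy dx`, with values in `[0, ∞]`. -/
def gagliardoEnergy {n : ℕ} (p q : ℝ) (D : Set (EuclideanSpace ℝ (Fin n)))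
    (u : EuclideanSpace ℝ (Fin n) → ℝ) : ℝ≥0∞ :=
  ∫⁻ x in D, ∫⁻ y in D, ENNReal.ofReal (|u y - u x| ^ p / ‖y - x‖ ^ q)

/-- The integral `∫_D |u|^p dx`, with values in `[0, ∞]`. -/
def powerIntegral {n : ℕ} (p : ℝ) (D : Set (EuclideanSpace ℝ (Fin n)))
    (u : EuclideanSpace ℝ (Fin n) → ℝ) : ℝ≥0∞ :=
  ∫⁻ x in D, ENNReal.ofReal (|u x| ^ p)

/-- The norm of `W^{s,p}(D)`, equal to `∞` if `u` does not have finite norm. -/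
def fracSobolevNorm {n : ℕ} (s p : ℝ) (D : Set (EuclideanSpace ℝ (Fin n)))
    (u : EuclideanSpace ℝ (Fin n) → ℝ) : ℝ≥0∞ :=
  (gagliardoEnergy p (n + s * p) D u + powerIntegral p D u) ^ (1 / p)

/-- `u` restricted to `D` belongs to `W^{s,p}(D)`. -/
def MemFracSobolev {n : ℕ} (s p : ℝ) (D : Set (EuclideanSpace ℝ (Fin n)))
    (u : EuclideanSpace ℝ (Fin n) → ℝ) : Prop :=
  AEStronglyMeasurable u (volume.restrict D) ∧ fracSobolevNorm s p D u < ⊤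

/-- `W₀^{s,p}(D)`: the closure of `C₀^∞(D)` in `W^{s,p}(D)` with respect to the norm of
`W^{s,p}(D)`; its members are extended by zero to the whole space. -/
def fracSobolevZero {n : ℕ} (s p : ℝ) (D : Set (EuclideanSpace ℝ (Fin n))) :
    Set (EuclideanSpace ℝ (Fin n) → ℝ) :=
  {u | MemFracSobolev s p D u ∧ (∀ x, x ∉ D → u x = 0) ∧
    ∀ ε : ℝ≥0∞, 0 < ε →
      ∃ φ, IsTestFunction D φ ∧ fracSobolevNorm s p D (fun x => u x - φ x) < ε}

/-- The fractional Rayleigh quotient, with both integrals over the whole space. -/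
def rayleighQuotient {n : ℕ} (α p : ℝ) (u : EuclideanSpace ℝ (Fin n) → ℝ) : ℝ≥0∞ :=
  gagliardoEnergy p (α * p) Set.univ u / powerIntegral p Set.univ u

/-- The first eigenvalue `λ₁`: the infimum of the Rayleigh quotient over all
`φ ∈ C₀^∞(Ω)` that do not vanish identically. -/
def firstEigenvalue {n : ℕ} (α p : ℝ) (Ω : Set (EuclideanSpace ℝ (Fin n))) : ℝ≥0∞ :=
  ⨅ (φ : EuclideanSpace ℝ (Fin n) → ℝ) (_ : IsTestFunction Ω φ) (_ : φ ≠ 0),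
    rayleighQuotient α p φ

/-- `u` is a nontrivial minimizer of the Rayleigh quotient in `W₀^{s,p}(Ω)`,
where `s = α - n / p`. -/
def IsRayleighMinimizer {n : ℕ} (α p : ℝ) (Ω : Set (EuclideanSpace ℝ (Fin n)))
    (u : EuclideanSpace ℝ (Fin n) → ℝ) : Prop :=
  u ∈ fracSobolevZero (α - n / p) p Ω ∧ ¬ (u =ᵐ[volume] 0) ∧
    ∀ v ∈ fracSobolevZero (α - n / p) p Ω, ¬ (v =ᵐ[volume] 0) →
      rayleighQuotient α p u ≤ rayleighQuotient α p v

/-- The weak Euler–Lagrange equation in `Ω` with parameter `lam`; the convergence of the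
integrals on both sides is part of the definition. -/
def SatisfiesEulerLagrange {n : ℕ} (α p : ℝ) (Ω : Set (EuclideanSpace ℝ (Fin n))) (lam : ℝ)
    (u : EuclideanSpace ℝ (Fin n) → ℝ) : Prop :=
  ∀ φ : EuclideanSpace ℝ (Fin n) → ℝ, IsTestFunction Ω φ →
    Integrable (fun z : EuclideanSpace ℝ (Fin n) × EuclideanSpace ℝ (Fin n) =>
      |u z.2 - u z.1| ^ (p - 2) * (u z.2 - u z.1) * (φ z.2 - φ z.1) / ‖z.2 - z.1‖ ^ (α * p)) ∧
    Integrable (fun x => |u x| ^ (p - 2) * u x * φ x) ∧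
    ∫ z : EuclideanSpace ℝ (Fin n) × EuclideanSpace ℝ (Fin n),
      |u z.2 - u z.1| ^ (p - 2) * (u z.2 - u z.1) * (φ z.2 - φ z.1) / ‖z.2 - z.1‖ ^ (α * p)
      = lam * ∫ x, |u x| ^ (p - 2) * u x * φ x

/-- `v ∈ C^{0,β}(ℝⁿ)`: `v` is bounded and Hölder continuous with exponent `β`. -/
def MemHolderSpace {n : ℕ} (β : ℝ) (v : EuclideanSpace ℝ (Fin n) → ℝ) : Prop :=
  (∃ M : ℝ, ∀ x, |v x| ≤ M) ∧ ∃ C : ℝ, ∀ x y, |v x - v y| ≤ C * ‖x - y‖ ^ β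

end

/-! Write [u] for the `L^p` norm of `diffQuot α u`. Since n + sp = αp, this linear difference
quotient gives both the seminorm of W^{s,p}(D), integrated over D × D, and the numerator of the
Rayleigh quotient, integrated over all pairs of points.

The two domains of integration differ, and that is the main obstacle to the lower bound λ₁ ≤ R(v) on
W₀^{s,p}: convergence of test functions in the defining norm does not control pairs with a point
outside D, and the boundary of D is arbitrary. If [v] = ∞ there is nothing to prove. Otherwise the
approximation error is clamped between -|v| and |v|. The clamped error tends to zero in the full
seminorm, because outside D × D it is dominated by v itself, and subtracting it from v leaves a
function with compact support in D (`exists_compact_support_approx`). Such a function is mollified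
to test functions without raising the seminorm (`le_diffQuot_of_compact_support`).

Existence is the direct method. A normalized minimizing sequence of nonnegative test functions has
an `L^p`-Cauchy subsequence, because averaging over small cubes is uniformly close to the identity
when αp > n (`exists_subseq_cauchy`). Clarkson's inequality, where p ≥ 2 enters, then makes the
sequence Cauchy in the seminorm (`cauchy_diffQuot_of_minimizing`). The limit is therefore a strong
one and lies in W₀^{s,p}, which is a norm closure; Fatou gives [u]^p ≤ λ₁.

For a minimizer u, the function t ↦ [u + tφ]^p - λ₁‖u + tφ‖^p is nonnegative and vanishes at t = 0,
so its derivative there is zero; this is the Euler–Lagrange equation. For αp > 2n, means over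
comparable nearby balls of radius about r differ by at most C [u] r^β, and Campanato's argument
gives a Hölder representative. The same estimate, applied to the clamped errors, makes it vanish at
every point outside D. -/

section FractionalRayleigh

open Filter Topology Set

variable {n : ℕ}

local notation "𝔼" => EuclideanSpace ℝ (Fin n)

/-! ### The difference quotient and its `L^p` norms -/

/-- The difference quotient of order `α`; its `L^p` norm is the Gagliardo seminorm. -/
noncomputable def diffQuot (α : ℝ) (u : 𝔼 → ℝ) (z : 𝔼 × 𝔼) : ℝ :=
  (u z.2 - u z.1) / ‖z.2 - z.1‖ ^ α

lemma diffQuot_add (α : ℝ) (u v : 𝔼 → ℝ) :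
    diffQuot α (u + v) = diffQuot α u + diffQuot α v := by
  ext z; simp only [diffQuot, Pi.add_apply]; ring

lemma diffQuot_sub (α : ℝ) (u v : 𝔼 → ℝ) :
    diffQuot α (u - v) = diffQuot α u - diffQuot α v := by
  ext z; simp only [diffQuot, Pi.sub_apply]; ring

lemma diffQuot_smul (α c : ℝ) (u : 𝔼 → ℝ) : diffQuot α (c • u) = c • diffQuot α u := by
  ext z; simp only [diffQuot, Pi.smul_apply, smul_eq_mul]; ring

lemma abs_diffQuot (α : ℝ) (u : 𝔼 → ℝ) (z : 𝔼 × 𝔼) :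
    |diffQuot α u z| = |u z.2 - u z.1| / ‖z.2 - z.1‖ ^ α := by
  rw [diffQuot, abs_div, abs_of_nonneg (a := _ ^ α) (by positivity)]

lemma aestronglyMeasurable_diffQuot (α : ℝ) {u : 𝔼 → ℝ} {D : Set 𝔼}
    (hu : AEStronglyMeasurable u (volume.restrict D)) :
    AEStronglyMeasurable (diffQuot α u) (volume.restrict (D ×ˢ D)) := by
  rw [Measure.volume_eq_prod, ← Measure.prod_restrict]
  have h : Measurable fun z : 𝔼 × 𝔼 => (‖z.2 - z.1‖ ^ α)⁻¹ := by fun_prop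
  have := (hu.comp_snd (μ := volume.restrict D)).sub (hu.comp_fst (ν := volume.restrict D))
  exact (this.mul h.aestronglyMeasurable).congr (ae_of_all _ fun z => by
    simp [diffQuot, div_eq_mul_inv])

lemma aestronglyMeasurable_diffQuot_univ (α : ℝ) {u : 𝔼 → ℝ} (hu : AEStronglyMeasurable u) :
    AEStronglyMeasurable (diffQuot α u) := by
  simpa using aestronglyMeasurable_diffQuot α (D := univ) (by simpa using hu)

lemma diffQuot_congr_ae (α : ℝ) {u v : 𝔼 → ℝ} (h : u =ᵐ[volume] v) :
    diffQuot α u =ᵐ[volume] diffQuot α v := by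
  have h1 := (Measure.quasiMeasurePreserving_fst (μ := (volume : Measure 𝔼))
    (ν := (volume : Measure 𝔼))).ae_eq_comp h
  have h2 := (Measure.quasiMeasurePreserving_snd (μ := (volume : Measure 𝔼))
    (ν := (volume : Measure 𝔼))).ae_eq_comp h
  filter_upwards [h1, h2] with z hz1 hz2
  simp only [Function.comp] at hz1 hz2
  simp only [diffQuot, hz1, hz2]

lemma eLpNorm_ofReal_rpow {X : Type*} [MeasurableSpace X] {p : ℝ} (hp : 0 < p) (f : X → ℝ)
    (μ : Measure X) : eLpNorm f (ENNReal.ofReal p) μ ^ p = ∫⁻ x, ‖f x‖ₑ ^ p ∂μ := by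
  rw [eLpNorm_eq_lintegral_rpow_enorm_toReal (by simpa using hp) ENNReal.ofReal_ne_top,
    ENNReal.toReal_ofReal hp.le, ← ENNReal.rpow_mul, one_div_mul_cancel hp.ne', ENNReal.rpow_one]

lemma enorm_rpow_eq_ofReal {p : ℝ} (hp : 0 < p) (a : ℝ) :
    ‖a‖ₑ ^ p = ENNReal.ofReal (|a| ^ p) := by
  rw [Real.enorm_eq_ofReal_abs, ENNReal.ofReal_rpow_of_nonneg (abs_nonneg a) hp.le]

lemma powerIntegral_eq {p : ℝ} (hp : 0 < p) (D : Set 𝔼) (u : 𝔼 → ℝ) :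
    powerIntegral p D u = eLpNorm u (ENNReal.ofReal p) (volume.restrict D) ^ p := by
  rw [eLpNorm_ofReal_rpow hp, powerIntegral]
  simp only [enorm_rpow_eq_ofReal hp]

lemma abs_diffQuot_rpow (α p : ℝ) (u : 𝔼 → ℝ) (z : 𝔼 × 𝔼) :
    |diffQuot α u z| ^ p = |u z.2 - u z.1| ^ p / ‖z.2 - z.1‖ ^ (α * p) := by
  rw [abs_diffQuot, Real.div_rpow (abs_nonneg _) (by positivity), ← Real.rpow_mul (norm_nonneg _)]

lemma gagliardoEnergy_eq {α p : ℝ} (hp : 0 < p) (D : Set 𝔼) {u : 𝔼 → ℝ}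
    (hu : AEStronglyMeasurable u (volume.restrict D)) :
    gagliardoEnergy p (α * p) D u =
      eLpNorm (diffQuot α u) (ENNReal.ofReal p) (volume.restrict (D ×ˢ D)) ^ p := by
  have hm := (aestronglyMeasurable_diffQuot α hu).enorm.pow_const p
  rw [eLpNorm_ofReal_rpow hp]
  rw [Measure.volume_eq_prod, ← Measure.prod_restrict] at hm ⊢
  rw [lintegral_prod _ hm, gagliardoEnergy]
  simp only [enorm_rpow_eq_ofReal hp, abs_diffQuot_rpow]

lemma rayleighQuotient_eq {α p : ℝ} (hp : 0 < p) {u : 𝔼 → ℝ} (hu : AEStronglyMeasurable u) :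
    rayleighQuotient α p u =
      eLpNorm (diffQuot α u) (ENNReal.ofReal p) ^ p / eLpNorm u (ENNReal.ofReal p) ^ p := by
  rw [rayleighQuotient, gagliardoEnergy_eq hp univ (by simpa using hu), powerIntegral_eq hp]
  simp

/-! ### The space `W₀^{s,p}` -/

lemma sobolev_exponent {α p : ℝ} (hp : 0 < p) : (n : ℝ) + (α - n / p) * p = α * p := by
  field_simp; ring

lemma aestronglyMeasurable_of_restrict {D : Set 𝔼} (hD : IsOpen D) {u : 𝔼 → ℝ}
    (hu : AEStronglyMeasurable u (volume.restrict D)) (h0 : ∀ x, x ∉ D → u x = 0) :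
    AEStronglyMeasurable u := by
  have : D.indicator u = u := indicator_eq_self.2 fun x hx => by
    by_contra h; exact hx (h0 x h)
  rw [← this]
  exact (aestronglyMeasurable_indicator_iff hD.measurableSet).2 hu

lemma eLpNorm_restrict_of_zero {D : Set 𝔼} {p : ℝ≥0∞} {u : 𝔼 → ℝ}
    (h0 : ∀ x, x ∉ D → u x = 0) : eLpNorm u p (volume.restrict D) = eLpNorm u p :=
  eLpNorm_restrict_eq_of_support_subset fun x hx => by
    by_contra h; exact hx (h0 x h)

lemma fracSobolevNorm_eq {α p : ℝ} (hp : 0 < p) {D : Set 𝔼} {u : 𝔼 → ℝ}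
    (hu : AEStronglyMeasurable u (volume.restrict D)) (h0 : ∀ x, x ∉ D → u x = 0) :
    fracSobolevNorm (α - n / p) p D u =
      (eLpNorm (diffQuot α u) (ENNReal.ofReal p) (volume.restrict (D ×ˢ D)) ^ p
        + eLpNorm u (ENNReal.ofReal p) ^ p) ^ (1 / p) := by
  rw [fracSobolevNorm, sobolev_exponent hp, gagliardoEnergy_eq hp _ hu, powerIntegral_eq hp,
    eLpNorm_restrict_of_zero h0]

lemma fracSobolevNorm_le {α p : ℝ} (hp : 1 ≤ p) {D : Set 𝔼} {u : 𝔼 → ℝ}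
    (hu : AEStronglyMeasurable u (volume.restrict D)) (h0 : ∀ x, x ∉ D → u x = 0) :
    fracSobolevNorm (α - n / p) p D u ≤
      eLpNorm (diffQuot α u) (ENNReal.ofReal p) (volume.restrict (D ×ˢ D))
        + eLpNorm u (ENNReal.ofReal p) := by
  have hp0 : 0 < p := by linarith
  rw [fracSobolevNorm_eq hp0 hu h0]
  refine (ENNReal.rpow_add_le_add_rpow _ _ (by positivity) ?_).trans_eq ?_
  · rw [div_le_one hp0]; exact hp
  · simp only [← ENNReal.rpow_mul, mul_one_div_cancel hp0.ne', ENNReal.rpow_one]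

lemma le_fracSobolevNorm {α p : ℝ} (hp : 0 < p) {D : Set 𝔼} {u : 𝔼 → ℝ}
    (hu : AEStronglyMeasurable u (volume.restrict D)) (h0 : ∀ x, x ∉ D → u x = 0) :
    eLpNorm (diffQuot α u) (ENNReal.ofReal p) (volume.restrict (D ×ˢ D)) ≤
      fracSobolevNorm (α - n / p) p D u ∧
    eLpNorm u (ENNReal.ofReal p) ≤ fracSobolevNorm (α - n / p) p D u := by
  have key : ∀ a b : ℝ≥0∞, a ≤ (a ^ p + b ^ p) ^ (1 / p) := fun a b => by
    rw [one_div, ENNReal.le_rpow_inv_iff hp]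
    exact le_self_add
  rw [fracSobolevNorm_eq hp hu h0]
  refine ⟨key _ _, ?_⟩
  rw [add_comm]
  exact key _ _

namespace IsTestFunction

lemma eq_zero {D : Set 𝔼} {φ : 𝔼 → ℝ} (h : IsTestFunction D φ) : ∀ x, x ∉ D → φ x = 0 := fun _ hx =>
  image_eq_zero_of_notMem_tsupport fun h' => hx (h.2.2 h')

lemma continuous {D : Set 𝔼} {φ : 𝔼 → ℝ} (h : IsTestFunction D φ) : Continuous φ := h.1.continuous

lemma aestronglyMeasurable {D : Set 𝔼} {φ : 𝔼 → ℝ} (h : IsTestFunction D φ) {μ : Measure 𝔼} :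
    AEStronglyMeasurable φ μ := h.continuous.aestronglyMeasurable

lemma memLp {D : Set 𝔼} {φ : 𝔼 → ℝ} (h : IsTestFunction D φ) (p : ℝ≥0∞) : MemLp φ p :=
  h.continuous.memLp_of_hasCompactSupport h.2.1

lemma const_smul {D : Set 𝔼} {φ : 𝔼 → ℝ} (h : IsTestFunction D φ) (c : ℝ) : IsTestFunction D (c • φ) :=
  ⟨h.1.const_smul c, h.2.1.smul_left (f := fun _ => c),
    (tsupport_smul_subset_right (fun _ => c) φ).trans h.2.2⟩

lemma add {D : Set 𝔼} {φ : 𝔼 → ℝ} {ψ : 𝔼 → ℝ} (h : IsTestFunction D φ) (h' : IsTestFunction D ψ) :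
    IsTestFunction D (φ + ψ) :=
  ⟨h.1.add h'.1, h.2.1.add h'.2.1, (tsupport_add φ ψ).trans (union_subset h.2.2 h'.2.2)⟩

end IsTestFunction

lemma mem_fracSobolevZero_of_tendsto {α p : ℝ} (hp : 1 ≤ p) {D : Set 𝔼} {u : 𝔼 → ℝ}
    (hu : AEStronglyMeasurable u) (h0 : ∀ x, x ∉ D → u x = 0)
    (hN : eLpNorm u (ENNReal.ofReal p) < ⊤)
    (hG : eLpNorm (diffQuot α u) (ENNReal.ofReal p) (volume.restrict (D ×ˢ D)) < ⊤)
    {φ : ℕ → 𝔼 → ℝ} (hφ : ∀ k, IsTestFunction D (φ k))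
    (hφN : Tendsto (fun k => eLpNorm (u - φ k) (ENNReal.ofReal p)) atTop (𝓝 0))
    (hφG : Tendsto (fun k => eLpNorm (diffQuot α (u - φ k)) (ENNReal.ofReal p)
      (volume.restrict (D ×ˢ D))) atTop (𝓝 0)) :
    u ∈ fracSobolevZero (α - n / p) p D := by
  refine ⟨⟨hu.restrict, ?_⟩, h0, fun ε hε => ?_⟩
  · exact (fracSobolevNorm_le hp hu.restrict h0).trans_lt (ENNReal.add_lt_top.2 ⟨hG, hN⟩)
  · have := hφG.add hφN
    rw [add_zero] at this
    obtain ⟨k, hk⟩ := (this.eventually (gt_mem_nhds hε)).exists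
    refine ⟨φ k, hφ k, lt_of_le_of_lt ?_ hk⟩
    exact fracSobolevNorm_le hp (u := u - φ k) (hu.sub (hφ k).aestronglyMeasurable).restrict
      fun x hx => by simp [h0 x hx, (hφ k).eq_zero x hx]

/-- The definition unpacked into `L^p` terms. Finiteness and convergence of the seminorm are
available on D × D only; the seminorm over all pairs may be infinite. -/
lemma exists_seq_of_mem_fracSobolevZero {α p : ℝ} (hp : 1 ≤ p) {D : Set 𝔼} (hD : IsOpen D)
    {u : 𝔼 → ℝ} (hu : u ∈ fracSobolevZero (α - n / p) p D) :
    AEStronglyMeasurable u ∧ (∀ x, x ∉ D → u x = 0) ∧ eLpNorm u (ENNReal.ofReal p) < ⊤ ∧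
    eLpNorm (diffQuot α u) (ENNReal.ofReal p) (volume.restrict (D ×ˢ D)) < ⊤ ∧
    ∃ φ : ℕ → 𝔼 → ℝ, (∀ k, IsTestFunction D (φ k)) ∧
      Tendsto (fun k => eLpNorm (u - φ k) (ENNReal.ofReal p)) atTop (𝓝 0) ∧
      Tendsto (fun k => eLpNorm (diffQuot α (u - φ k)) (ENNReal.ofReal p)
        (volume.restrict (D ×ˢ D))) atTop (𝓝 0) := by
  obtain ⟨⟨hm, hfin⟩, h0, happ⟩ := hu
  have hp0 : 0 < p := by linarith
  have hm' := aestronglyMeasurable_of_restrict hD hm h0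
  refine ⟨hm', h0, (le_fracSobolevNorm hp0 hm h0).2.trans_lt hfin,
    (le_fracSobolevNorm hp0 hm h0).1.trans_lt hfin, ?_⟩
  choose φ hφ hlt using fun k : ℕ => happ ((k : ℝ≥0∞) + 1)⁻¹ (by simp)
  have hlim : Tendsto (fun k : ℕ => ((k : ℝ≥0∞) + 1)⁻¹) atTop (𝓝 0) := by
    have := ENNReal.tendsto_inv_nat_nhds_zero.comp (tendsto_add_atTop_nat 1)
    refine this.congr fun k => by simp
  have key := fun k => le_fracSobolevNorm (α := α) hp0 (u := u - φ k)
    (hm.sub (hφ k).aestronglyMeasurable)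
    (fun x hx => by simp [h0 x hx, (hφ k).eq_zero x hx])
  refine ⟨φ, hφ, ?_, ?_⟩
  · exact tendsto_of_tendsto_of_tendsto_of_le_of_le tendsto_const_nhds hlim (fun _ => zero_le)
      fun k => (key k).2.trans (hlt k).le
  · exact tendsto_of_tendsto_of_tendsto_of_le_of_le tendsto_const_nhds hlim (fun _ => zero_le)
      fun k => (key k).1.trans (hlt k).le


/-! ### Test functions have finite energy -/

/-- Near the origin the integrand is at most L^p ‖h‖^(p - αp), integrable because αp < n + p; far
away it is at most M^p ‖h‖^(-αp), integrable because αp > n. -/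
lemma integrable_min_rpow_div {α p : ℝ} (hn : 1 ≤ n) (hp : 0 < p) (hlow : (n : ℝ) < α * p)
    (hupp : α * p < n + p) {L M : ℝ} (hL : 0 ≤ L) (hM : 0 ≤ M) :
    Integrable (fun h : 𝔼 => min (L * ‖h‖) M ^ p / ‖h‖ ^ (α * p)) := by
  have hmeas : Measurable (fun h : 𝔼 => min (L * ‖h‖) M ^ p / ‖h‖ ^ (α * p)) := by fun_prop
  have hnn : ∀ h : 𝔼, 0 ≤ min (L * ‖h‖) M := fun h => le_min (by positivity) hM
  have hαp : 0 < α * p := (Nat.cast_nonneg n).trans_lt hlow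
  have hin : IntegrableOn (fun h : 𝔼 => min (L * ‖h‖) M ^ p / ‖h‖ ^ (α * p))
      (Metric.ball 0 1) := by
    refine integrableOn_ball_of_norm_le_rpow (C := L ^ p) (α := α * p - p) (by simpa using hn)
      (by simp; linarith) (ae_of_all _ fun h => ?_) hmeas.aestronglyMeasurable
    have h1 : 0 ≤ min (L * ‖h‖) M ^ p := Real.rpow_nonneg (hnn h) _
    rw [Real.norm_of_nonneg (by positivity)]
    rcases eq_or_ne h 0 with rfl | hh
    · simp only [norm_zero, Real.zero_rpow hαp.ne', div_zero]
      positivity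
    · have hh' : 0 < ‖h‖ := norm_pos_iff.2 hh
      rw [neg_sub, Real.rpow_sub hh', ← mul_div_assoc, ← Real.mul_rpow hL hh'.le]
      gcongr
      exact min_le_left _ _
  have hout : IntegrableOn (fun h : 𝔼 => min (L * ‖h‖) M ^ p / ‖h‖ ^ (α * p))
      (Metric.ball 0 1)ᶜ := by
    have hI := (integrable_one_add_norm (E := 𝔼) (μ := volume) (r := α * p)
      (by simpa using hlow)).const_mul (M ^ p * 2 ^ (α * p))
    refine Integrable.mono' hI.integrableOn hmeas.aestronglyMeasurable ?_
    filter_upwards [ae_restrict_mem Metric.isOpen_ball.measurableSet.compl] with h hh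
    have hh' : 1 ≤ ‖h‖ := by simpa using hh
    have hh0 : 0 < ‖h‖ := by linarith
    have h1 : 0 ≤ min (L * ‖h‖) M ^ p := Real.rpow_nonneg (hnn h) _
    rw [Real.norm_of_nonneg (by positivity), Real.rpow_neg (by positivity), mul_assoc,
      ← div_eq_mul_inv, ← Real.div_rpow (by norm_num) (by positivity), div_eq_mul_inv,
      ← Real.inv_rpow hh0.le]
    gcongr
    · exact min_le_right _ _
    · rw [inv_le_comm₀ hh0 (by positivity), inv_div]
      linarith
  have := hin.union hout
  rwa [union_compl_self, integrableOn_univ] at this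

/-- A pair with both points off the support K contributes nothing. Every other pair has a point in
K, and the Lipschitz and sup bounds dominate the integrand by an integrable function of the
difference z.2 - z.1, so the energy is at most twice |K| times the integral of that function. -/
lemma IsTestFunction.eLpNorm_diffQuot_lt_top {α p : ℝ} (hn : 1 ≤ n) (hp : 1 ≤ p)
    (hlow : (n : ℝ) < α * p) (hupp : α * p < n + p) {D : Set 𝔼} {φ : 𝔼 → ℝ}
    (hφ : IsTestFunction D φ) : eLpNorm (diffQuot α φ) (ENNReal.ofReal p) < ⊤ := by
  have hp0 : 0 < p := by linarith
  obtain ⟨L, hL⟩ := hφ.1.lipschitzWith_of_hasCompactSupport hφ.2.1 (by simp)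
  obtain ⟨M, hM⟩ := hφ.continuous.bounded_above_of_compact_support hφ.2.1
  have hM0 : 0 ≤ M := (norm_nonneg _).trans (hM 0)
  set K := tsupport φ
  have hK : MeasurableSet K := (isClosed_tsupport φ).measurableSet
  set g : 𝔼 → ℝ := fun h => min (L * ‖h‖) (2 * M) ^ p / ‖h‖ ^ (α * p)
  have hg : Integrable g := integrable_min_rpow_div hn hp0 hlow hupp L.2 (by positivity)
  have hgm : Measurable g := by fun_prop
  set G : 𝔼 → ℝ≥0∞ := fun h => ENNReal.ofReal (g h)
  have hGm : Measurable G := hgm.ennreal_ofReal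
  have hG : ∫⁻ h, G h < ⊤ := hg.lintegral_lt_top
  have hKfin : volume K < ⊤ := hφ.2.1.measure_lt_top
  have hpt : ∀ z : 𝔼 × 𝔼, ‖diffQuot α φ z‖ₑ ^ p ≤
      K.indicator 1 z.1 * G (z.2 - z.1) + K.indicator 1 z.2 * G (z.2 - z.1) := by
    intro z
    have hle : ‖diffQuot α φ z‖ₑ ^ p ≤ G (z.2 - z.1) := by
      rw [enorm_rpow_eq_ofReal hp0, abs_diffQuot_rpow]
      apply ENNReal.ofReal_le_ofReal
      simp only [g]
      gcongr
      refine le_min ?_ ?_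
      · simpa [Real.dist_eq, dist_eq_norm] using hL.dist_le_mul z.2 z.1
      · calc |φ z.2 - φ z.1| ≤ |φ z.2| + |φ z.1| := abs_sub _ _
          _ ≤ 2 * M := by
            have h1 := hM z.1; have h2 := hM z.2
            simp only [Real.norm_eq_abs] at h1 h2
            linarith
    by_cases h1 : z.1 ∈ K
    · simp only [indicator_of_mem h1, Pi.one_apply, one_mul]
      exact hle.trans le_self_add
    by_cases h2 : z.2 ∈ K
    · simp only [indicator_of_mem h2, Pi.one_apply, one_mul]
      exact hle.trans le_add_self
    · rw [diffQuot, image_eq_zero_of_notMem_tsupport h1, image_eq_zero_of_notMem_tsupport h2]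
      simp [hp0]
  have hind : Measurable (K.indicator (1 : 𝔼 → ℝ≥0∞)) := measurable_one.indicator hK
  have hm1 : Measurable fun z : 𝔼 × 𝔼 => K.indicator (1 : 𝔼 → ℝ≥0∞) z.1 * G (z.2 - z.1) := by
    fun_prop
  have hm2 : Measurable fun z : 𝔼 × 𝔼 => K.indicator (1 : 𝔼 → ℝ≥0∞) z.2 * G (z.2 - z.1) := by
    fun_prop
  rw [← ENNReal.rpow_lt_top_iff_of_pos hp0, eLpNorm_ofReal_rpow hp0]
  refine (lintegral_mono hpt).trans_lt ?_
  rw [lintegral_add_left hm1, Measure.volume_eq_prod, lintegral_prod _ hm1.aemeasurable,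
    lintegral_prod_symm _ hm2.aemeasurable]
  have e1 : ∀ x : 𝔼, ∫⁻ y, K.indicator (1 : 𝔼 → ℝ≥0∞) x * G (y - x)
      = K.indicator 1 x * ∫⁻ h, G h := fun x => by
    rw [lintegral_const_mul _ (by fun_prop), lintegral_sub_right_eq_self]
  have e2 : ∀ y : 𝔼, ∫⁻ x, K.indicator (1 : 𝔼 → ℝ≥0∞) y * G (y - x)
      = K.indicator 1 y * ∫⁻ h, G h := fun x => by
    rw [lintegral_const_mul _ (by fun_prop), lintegral_sub_left_eq_self]
  simp only [e1, e2]
  rw [lintegral_mul_const _ hind, lintegral_indicator_one hK]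
  exact ENNReal.add_lt_top.2 ⟨ENNReal.mul_lt_top hKfin hG, ENNReal.mul_lt_top hKfin hG⟩

/-! ### Mollification -/

lemma enorm_integral_rpow_le {X : Type*} [MeasurableSpace X] {ν : Measure X}
    [IsProbabilityMeasure ν] {p : ℝ} (hp : 1 ≤ p) {f : X → ℝ} (hf : AEStronglyMeasurable f ν) :
    (∫⁻ x, ‖f x‖ₑ ∂ν) ^ p ≤ ∫⁻ x, ‖f x‖ₑ ^ p ∂ν := by
  have hp0 : 0 < p := by linarith
  rw [← eLpNorm_ofReal_rpow hp0, ← eLpNorm_one_eq_lintegral_enorm]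
  gcongr
  exact eLpNorm_le_eLpNorm_of_exponent_le (by simpa using hp) hf

open scoped Convolution in
-- A mollification is an average of translates, and translating u moves `diffQuot α u` along the
-- diagonal direction (t, t) without changing the kernel. Jensen's inequality for the probability
-- measure ν, followed by Tonelli and translation invariance, gives the bound.
lemma eLpNorm_diffQuot_convolution_le {α p : ℝ} (hp : 1 ≤ p) (η : ContDiffBump (0 : 𝔼))
    {w : 𝔼 → ℝ} (hw : StronglyMeasurable w) (hwl : LocallyIntegrable w) :
    eLpNorm (diffQuot α (η.normed volume ⋆[ContinuousLinearMap.lsmul ℝ ℝ, volume] w))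
      (ENNReal.ofReal p) ≤ eLpNorm (diffQuot α w) (ENNReal.ofReal p) := by
  have hp0 : 0 < p := by linarith
  set ρ : 𝔼 → ℝ := η.normed volume
  have hρc : Continuous ρ := η.continuous_normed
  have hρ0 : ∀ t, 0 ≤ ρ t := η.nonneg_normed
  have hρi : Integrable ρ := η.integrable_normed
  set ν : Measure 𝔼 := volume.withDensity fun t => ENNReal.ofReal (ρ t)
  have hν : IsProbabilityMeasure ν := ⟨by
    rw [withDensity_apply _ MeasurableSet.univ, Measure.restrict_univ,
      ← ofReal_integral_eq_lintegral_ofReal hρi (ae_of_all _ hρ0), η.integral_normed,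
      ENNReal.ofReal_one]⟩
  have hDm : Measurable (diffQuot α w) := by
    have := hw.measurable
    unfold diffQuot
    fun_prop
  have hex : ∀ x, Integrable fun t => ρ t * w (x - t) := fun x =>
    (η.hasCompactSupport_normed.convolutionExists_left
      (ContinuousLinearMap.lsmul ℝ ℝ) hρc hwl x)
  have hrep : ∀ z : 𝔼 × 𝔼,
      diffQuot α (ρ ⋆[ContinuousLinearMap.lsmul ℝ ℝ, volume] w) z
        = ∫ t, ρ t * diffQuot α w (z - (t, t)) := by
    intro z
    have : ∀ t, ρ t * diffQuot α w (z - (t, t))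
        = (ρ t * w (z.2 - t) - ρ t * w (z.1 - t)) / ‖z.2 - z.1‖ ^ α := fun t => by
      simp only [diffQuot, Prod.snd_sub, Prod.fst_sub, sub_sub_sub_cancel_right]
      ring
    simp only [this]
    rw [integral_div, integral_sub (hex _) (hex _)]
    simp [diffQuot, convolution]
  have hpt : ∀ z : 𝔼 × 𝔼,
      ‖diffQuot α (ρ ⋆[ContinuousLinearMap.lsmul ℝ ℝ, volume] w) z‖ₑ ^ p
        ≤ ∫⁻ t, ‖diffQuot α w (z - (t, t))‖ₑ ^ p ∂ν := by
    intro z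
    have hzm : Measurable fun t : 𝔼 => diffQuot α w (z - (t, t)) := by fun_prop
    refine le_trans ?_ (enorm_integral_rpow_le hp hzm.aestronglyMeasurable)
    gcongr
    rw [hrep, lintegral_withDensity_eq_lintegral_mul _ (by fun_prop) hzm.enorm]
    refine (enorm_integral_le_lintegral_enorm _).trans_eq (lintegral_congr fun t => ?_)
    simp [enorm_mul, Real.enorm_of_nonneg (hρ0 t)]
  rw [← ENNReal.rpow_le_rpow_iff hp0, eLpNorm_ofReal_rpow hp0, eLpNorm_ofReal_rpow hp0]
  refine (lintegral_mono hpt).trans ?_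
  rw [lintegral_lintegral_swap (by
    refine Measurable.aemeasurable ?_
    unfold Function.uncurry
    fun_prop)]
  have hinv : (volume : Measure (𝔼 × 𝔼)).IsAddRightInvariant := by
    rw [Measure.volume_eq_prod]; infer_instance
  have : ∀ t : 𝔼, ∫⁻ z : 𝔼 × 𝔼, ‖diffQuot α w (z - (t, t))‖ₑ ^ p
      = ∫⁻ z : 𝔼 × 𝔼, ‖diffQuot α w z‖ₑ ^ p := fun t =>
    lintegral_sub_right_eq_self (fun z => ‖diffQuot α w z‖ₑ ^ p) (t, t)
  simp [this]

/-- A lower bound for the Gagliardo seminorm on test functions extends to functions with compact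
support in `D`. -/
lemma le_diffQuot_of_compact_support {α p : ℝ} (hp : 1 ≤ p) {D : Set 𝔼} (hD : IsOpen D)
    {c : ℝ≥0∞} (hc : c ≠ ⊤)
    (hle : ∀ φ, IsTestFunction D φ →
      c * eLpNorm φ (ENNReal.ofReal p) ≤ eLpNorm (diffQuot α φ) (ENNReal.ofReal p))
    {w : 𝔼 → ℝ} (hw : AEStronglyMeasurable w) (hwN : eLpNorm w (ENNReal.ofReal p) < ⊤)
    {K : Set 𝔼} (hK : IsCompact K) (hKD : K ⊆ D) (hwK : ∀ x, x ∉ K → w x = 0) :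
    c * eLpNorm w (ENNReal.ofReal p) ≤ eLpNorm (diffQuot α w) (ENNReal.ofReal p) := by
  have hp0 : 0 < p := by linarith
  -- Passing to a strongly measurable representative; the indicator of K keeps the support condition
  -- valid at every point.
  wlog hws : StronglyMeasurable w generalizing w
  · set w' := K.indicator (hw.mk w)
    have hae : w =ᵐ[volume] w' := by
      filter_upwards [hw.ae_eq_mk] with x hx
      by_cases h : x ∈ K
      · simp [w', h, hx]
      · simp [w', h, hwK x h]
    have hs : StronglyMeasurable w' := hw.stronglyMeasurable_mk.indicator hK.measurableSet
    rw [eLpNorm_congr_ae hae, eLpNorm_congr_ae (diffQuot_congr_ae α hae)]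
    exact this hs.aestronglyMeasurable (by rwa [← eLpNorm_congr_ae hae])
      (fun x hx => by simp [w', hx]) hs
  have hP : 1 ≤ ENNReal.ofReal p := by simpa using hp
  have hwl : LocallyIntegrable w := MemLp.locallyIntegrable ⟨hw, hwN⟩ hP
  obtain ⟨δ, hδ, hδD⟩ := hK.exists_cthickening_subset_open hD hKD
  -- The outer radius never exceeds δ, so supports stay in the δ-thickening of K inside D. The fixed
  -- ratio 2 between the radii is what the almost everywhere convergence of the mollifications
  -- requires.
  let η : ℕ → ContDiffBump (0 : 𝔼) := fun k =>
    ⟨δ / 2 / (k + 2), δ / (k + 2), by positivity, by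
      rw [div_right_comm]; exact half_lt_self (by positivity)⟩
  have hηlim : Tendsto (fun k => (η k).rOut) atTop (𝓝 0) := by
    have := (tendsto_natCast_atTop_atTop (R := ℝ)).atTop_add (tendsto_const_nhds (x := (2 : ℝ)))
    exact this.const_div_atTop δ
  have hae := ContDiffBump.ae_convolution_tendsto_right_of_locallyIntegrable (K := 2)
    (μ := volume) hηlim (Eventually.of_forall fun k => by
      simp only [η]; apply le_of_eq; ring) hwl
  set W : ℕ → 𝔼 → ℝ := fun k =>
    MeasureTheory.convolution ((η k).normed volume) w (ContinuousLinearMap.lsmul ℝ ℝ) volume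
  have hsup : ∀ k, tsupport (W k) ⊆ Metric.cthickening δ K := by
    intro k
    refine closure_minimal ?_ Metric.isClosed_cthickening
    refine (support_convolution_subset _).trans ?_
    rintro _ ⟨a, ha, b, hb, rfl⟩
    have hbK : b ∈ K := by by_contra h; exact hb (hwK b h)
    refine Metric.mem_cthickening_of_dist_le _ b _ _ hbK ?_
    rw [(η k).support_normed_eq] at ha
    have hr : (η k).rOut ≤ δ := div_le_self hδ.le (by linarith [Nat.cast_nonneg (α := ℝ) k])
    have : dist (a + b) b = dist a 0 := by simp [dist_eq_norm]
    rw [this]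
    exact (Metric.mem_ball.1 ha).le.trans hr
  have htest : ∀ k, IsTestFunction D (W k) := fun k =>
    ⟨(η k).hasCompactSupport_normed.contDiff_convolution_left _ (η k).contDiff_normed hwl,
      HasCompactSupport.of_support_subset_isCompact (hK.cthickening)
        ((subset_tsupport _).trans (hsup k)), (hsup k).trans hδD⟩
  have hbound : ∀ k, c * eLpNorm (W k) (ENNReal.ofReal p)
      ≤ eLpNorm (diffQuot α w) (ENNReal.ofReal p) := fun k =>
    (hle _ (htest k)).trans (eLpNorm_diffQuot_convolution_le hp (η k) hws hwl)
  rcases eq_or_ne c 0 with rfl | hc0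
  · simp
  rw [mul_comm, ← ENNReal.le_div_iff_mul_le (Or.inl hc0) (Or.inl hc)]
  -- Fatou: a uniform bound on the `L^p` norms of the mollifications passes to their almost
  -- everywhere limit.
  refine Lp.eLpNorm_le_of_ae_tendsto (u := atTop) (Eventually.of_forall fun k => ?_)
    (fun k => (htest k).aestronglyMeasurable) hae
  rw [ENNReal.le_div_iff_mul_le (Or.inl hc0) (Or.inl hc), mul_comm]
  exact hbound k

/-! ### Truncation: approximation in the full seminorm by compactly supported functions -/

lemma abs_max_neg_min_le (a d : ℝ) :
    |max (-|a|) (min |a| d)| ≤ |a| ∧ |max (-|a|) (min |a| d)| ≤ |d| := by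
  rcases abs_cases a with h | h <;> rcases abs_cases d with h' | h' <;>
    constructor <;> rw [abs_le] <;> grind

/-- The clamp of d to [-|a|, |a|] is composed of `max`, `min` and the absolute value, each
1-Lipschitz in the sup norm. Increments of the clamped error are thus bounded by those of u or of
the original error. -/
lemma abs_max_neg_min_sub_le (a d a' d' : ℝ) :
    |max (-|a|) (min |a| d) - max (-|a'|) (min |a'| d')| ≤ max |a - a'| |d - d'| := by
  have h1 : |(|a| - |a'|)| ≤ |a - a'| := abs_abs_sub_abs_le a a'
  have h2 : |(-|a|) - (-|a'|)| = |(|a| - |a'|)| := by rw [← abs_neg]; congr 1; ring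
  refine (abs_max_sub_max_le_max _ _ _ _).trans (max_le ?_ ?_)
  · rw [h2]; exact h1.trans (le_max_left _ _)
  · exact (abs_min_sub_min_le_max _ _ _ _).trans (max_le_max h1 le_rfl)

lemma ae_diffQuot_tendsto_zero (α : ℝ) {e : ℕ → 𝔼 → ℝ}
    (he : ∀ᵐ x, Tendsto (fun k => e k x) atTop (𝓝 0)) :
    ∀ᵐ z : 𝔼 × 𝔼, Tendsto (fun k => diffQuot α (e k) z) atTop (𝓝 0) := by
  have h1 := (Measure.quasiMeasurePreserving_fst (μ := (volume : Measure 𝔼))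
    (ν := (volume : Measure 𝔼))).ae he
  have h2 := (Measure.quasiMeasurePreserving_snd (μ := (volume : Measure 𝔼))
    (ν := (volume : Measure 𝔼))).ae he
  filter_upwards [h1, h2] with z hz1 hz2
  simpa [diffQuot] using (hz2.sub hz1).div_const (‖z.2 - z.1‖ ^ α)

/-- Take test functions φ approximating u, put d = u - φ, and let e be d clamped to [-|u|, |u|].
Where φ = 0 the clamp returns u, so u - e is supported in the support of φ. The clamp makes e vanish
off D and controls its increments there by those of u, which is what convergence over pairs outside
D × D needs. -/
lemma exists_compact_support_approx {α p : ℝ} (hp : 1 ≤ p) {D : Set 𝔼} (hD : IsOpen D)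
    {u : 𝔼 → ℝ} (hu : u ∈ fracSobolevZero (α - n / p) p D)
    (hG : eLpNorm (diffQuot α u) (ENNReal.ofReal p) < ⊤) :
    ∃ e : ℕ → 𝔼 → ℝ, (∀ k, AEStronglyMeasurable (e k)) ∧ (∀ k x, x ∉ D → e k x = 0) ∧
      (∀ k, ∃ K ⊆ D, IsCompact K ∧ ∀ x, x ∉ K → (u - e k) x = 0) ∧
      Tendsto (fun k => eLpNorm (e k) (ENNReal.ofReal p)) atTop (𝓝 0) ∧
      Tendsto (fun k => eLpNorm (diffQuot α (e k)) (ENNReal.ofReal p)) atTop (𝓝 0) := by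
  have hp0 : 0 < p := by linarith
  have hP0 : ENNReal.ofReal p ≠ 0 := by simpa using hp0
  obtain ⟨hm, h0, hN, -, φ, hφ, hφN, hφG⟩ := exists_seq_of_mem_fracSobolevZero hp hD hu
  have hdm : ∀ k, AEStronglyMeasurable (u - φ k) := fun k => hm.sub (hφ k).aestronglyMeasurable
  obtain ⟨ns, hns, hae⟩ := (tendstoInMeasure_of_tendsto_eLpNorm hP0 hdm
    (aestronglyMeasurable_zero (μ := volume) (α := 𝔼) (β := ℝ))
    (by simpa only [sub_zero] using hφN)).exists_seq_tendsto_ae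
  set d : ℕ → 𝔼 → ℝ := fun k => u - φ (ns k)
  set e : ℕ → 𝔼 → ℝ := fun k x => max (-|u x|) (min |u x| (d k x))
  have hem : ∀ k, AEStronglyMeasurable (e k) := fun k => by
    have h1 := hm.aemeasurable
    have h2 := (hdm (ns k)).aemeasurable
    exact (h1.abs.neg.max (h1.abs.min h2)).aestronglyMeasurable
  have heu : ∀ k x, |e k x| ≤ |u x| := fun k x => (abs_max_neg_min_le _ _).1
  have hed : ∀ k x, |e k x| ≤ |d k x| := fun k x => (abs_max_neg_min_le _ _).2
  have he0 : ∀ k x, x ∉ D → e k x = 0 := fun k x hx => by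
    have := heu k x
    rwa [h0 x hx, abs_zero, abs_nonpos_iff] at this
  refine ⟨e, hem, he0, fun k => ⟨tsupport (φ (ns k)), (hφ _).2.2, (hφ _).2.1, fun x hx => ?_⟩,
    ?_, ?_⟩
  · have : d k x = u x := by simp [d, image_eq_zero_of_notMem_tsupport hx]
    simp only [Pi.sub_apply, e, this, min_eq_right (le_abs_self (u x)),
      max_eq_right (neg_abs_le (u x)), sub_self]
  · exact tendsto_of_tendsto_of_tendsto_of_le_of_le tendsto_const_nhds
      (hφN.comp hns.tendsto_atTop) (fun _ => zero_le) fun k => eLpNorm_mono (hed k)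
  · have hae' : ∀ᵐ x, Tendsto (fun k => e k x) atTop (𝓝 0) := by
      filter_upwards [hae] with x hx
      exact squeeze_zero_norm (fun k => hed k x) (by simpa [d] using hx.abs)
    have haeD := ae_diffQuot_tendsto_zero α hae'
    set A : 𝔼 × 𝔼 → ℝ≥0∞ := fun z => ‖diffQuot α u z‖ₑ ^ p
    set F : ℕ → 𝔼 × 𝔼 → ℝ≥0∞ := fun k z => ‖diffQuot α (e k) z‖ₑ ^ p
    set H : ℕ → 𝔼 × 𝔼 → ℝ≥0∞ := fun k =>
      (D ×ˢ D).indicator fun z => ‖diffQuot α (d k) z‖ₑ ^ p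
    have hDD : MeasurableSet (D ×ˢ D) := hD.measurableSet.prod hD.measurableSet
    have hAm : AEMeasurable A := (aestronglyMeasurable_diffQuot_univ α hm).enorm.pow_const p
    have hFm : ∀ k, AEMeasurable (F k) := fun k =>
      (aestronglyMeasurable_diffQuot_univ α (hem k)).enorm.pow_const p
    have hHm : ∀ k, AEMeasurable (H k) := fun k =>
      ((aestronglyMeasurable_diffQuot_univ α (hdm (ns k))).enorm.pow_const p).indicator hDD
    have hAfin : ∫⁻ z, A z ≠ ⊤ := by
      rw [← eLpNorm_ofReal_rpow hp0]
      exact ENNReal.rpow_ne_top_of_nonneg hp0.le hG.ne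
    have hHlim : Tendsto (fun k => ∫⁻ z, H k z) atTop (𝓝 0) := by
      have : ∀ k, ∫⁻ z, H k z = eLpNorm (diffQuot α (u - φ (ns k))) (ENNReal.ofReal p)
          (volume.restrict (D ×ˢ D)) ^ p := fun k => by
        rw [lintegral_indicator hDD, eLpNorm_ofReal_rpow hp0]
      simp only [this]
      have h := (ENNReal.continuous_rpow_const (y := p)).tendsto 0
      rw [ENNReal.zero_rpow_of_pos hp0] at h
      exact h.comp (hφG.comp hns.tendsto_atTop)
    have hmono : ∀ {f g : 𝔼 → ℝ} {z : 𝔼 × 𝔼}, |f z.2 - f z.1| ≤ |g z.2 - g z.1| →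
        ‖diffQuot α f z‖ₑ ^ p ≤ ‖diffQuot α g z‖ₑ ^ p := by
      intro f g z h
      gcongr
      rw [enorm_le_iff_norm_le, Real.norm_eq_abs, Real.norm_eq_abs, abs_diffQuot, abs_diffQuot]
      gcongr
    -- Off D × D one of the points carries u = e = 0, and |e| ≤ |u| at the other gives F ≤ A. On D ×
    -- D the Lipschitz bound gives F ≤ max A H. The minimum with A is handled by dominated
    -- convergence, and H by convergence in the norm of W^{s,p}(D).
    have hFle : ∀ k z, F k z ≤ min (F k z) (A z) + H k z := by
      intro k z
      rcases le_total (F k z) (A z) with h | h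
      · rw [min_eq_left h]; exact le_self_add
      by_cases hz : z ∈ D ×ˢ D
      · have hH : H k z = ‖diffQuot α (d k) z‖ₑ ^ p := indicator_of_mem hz _
        rw [min_eq_right h, hH]
        rcases le_max_iff.1 (abs_max_neg_min_sub_le (u z.2) (d k z.2) (u z.1) (d k z.1)) with h' | h'
        · exact (hmono h').trans le_self_add
        · exact (hmono h').trans le_add_self
      · have : F k z ≤ A z := by
          apply hmono
          rcases not_and_or.1 hz with h1 | h1
          · rw [he0 k _ h1, h0 _ h1, sub_zero, sub_zero]; exact heu k _
          · rw [he0 k _ h1, h0 _ h1, zero_sub, zero_sub, abs_neg, abs_neg]; exact heu k _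
        rw [min_eq_left this]; exact le_self_add
    have hmin : Tendsto (fun k => ∫⁻ z, min (F k z) (A z)) atTop (𝓝 0) := by
      have := tendsto_lintegral_of_dominated_convergence' (F := fun k z => min (F k z) (A z))
        (f := fun _ => 0) A (fun k => (hFm k).min hAm)
        (fun k => ae_of_all _ fun z => min_le_right _ _) hAfin (by
          filter_upwards [haeD] with z hz
          have h := (ENNReal.continuous_rpow_const (y := p)).tendsto 0
          rw [ENNReal.zero_rpow_of_pos hp0] at h
          have h2 : Tendsto (fun k => ‖diffQuot α (e k) z‖ₑ) atTop (𝓝 0) := by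
            simpa [Function.comp_def] using (continuous_enorm.tendsto (0 : ℝ)).comp hz
          exact tendsto_of_tendsto_of_tendsto_of_le_of_le tendsto_const_nhds (h.comp h2)
            (fun _ => zero_le) fun k => min_le_left _ _)
      simpa using this
    have hFlim : Tendsto (fun k => ∫⁻ z, F k z) atTop (𝓝 0) := by
      have := hmin.add hHlim
      rw [add_zero] at this
      refine tendsto_of_tendsto_of_tendsto_of_le_of_le tendsto_const_nhds this
        (fun _ => zero_le) fun k => ?_
      exact (lintegral_mono (hFle k)).trans_eq (lintegral_add_right' _ (hHm k))
    have h := (ENNReal.continuous_rpow_const (y := p⁻¹)).tendsto 0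
    rw [ENNReal.zero_rpow_of_pos (inv_pos.2 hp0)] at h
    refine (h.comp hFlim).congr fun k => ?_
    simp only [Function.comp, F]
    rw [← eLpNorm_ofReal_rpow hp0, ENNReal.rpow_rpow_inv hp0.ne']

/-! ### The first eigenvalue as a lower bound on `W₀^{s,p}` -/

lemma one_le_ofReal {p : ℝ} (hp : 1 ≤ p) : 1 ≤ ENNReal.ofReal p := by simpa using hp

/-- The inequality holds for the compactly supported functions u - e k, and both `L^p` errors caused
by e k vanish in the limit. -/
lemma le_diffQuot_of_mem_fracSobolevZero {α p : ℝ} (hp : 1 ≤ p) {D : Set 𝔼} (hD : IsOpen D)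
    {c : ℝ≥0∞} (hc : c ≠ ⊤)
    (hle : ∀ φ, IsTestFunction D φ →
      c * eLpNorm φ (ENNReal.ofReal p) ≤ eLpNorm (diffQuot α φ) (ENNReal.ofReal p))
    {u : 𝔼 → ℝ} (hu : u ∈ fracSobolevZero (α - n / p) p D) :
    c * eLpNorm u (ENNReal.ofReal p) ≤ eLpNorm (diffQuot α u) (ENNReal.ofReal p) := by
  rcases eq_or_ne (eLpNorm (diffQuot α u) (ENNReal.ofReal p)) ⊤ with h | h
  · simp [h]
  have hP := one_le_ofReal hp
  obtain ⟨hm, h0, hN, -⟩ := exists_seq_of_mem_fracSobolevZero hp hD hu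
  obtain ⟨e, hem, -, hK, heN, heG⟩ := exists_compact_support_approx hp hD hu (lt_top_iff_ne_top.2 h)
  have key : ∀ᶠ k in atTop, c * eLpNorm u (ENNReal.ofReal p) ≤
      eLpNorm (diffQuot α u) (ENNReal.ofReal p) + (eLpNorm (diffQuot α (e k)) (ENNReal.ofReal p)
        + c * eLpNorm (e k) (ENNReal.ofReal p)) := by
    filter_upwards [heN.eventually (gt_mem_nhds zero_lt_one)] with k hk
    obtain ⟨K, hKD, hKc, hK0⟩ := hK k
    have h1 := le_diffQuot_of_compact_support hp hD hc hle (hm.sub (hem k))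
      ((eLpNorm_sub_le hm (hem k) hP).trans_lt (ENNReal.add_lt_top.2
        ⟨hN, hk.trans ENNReal.one_lt_top⟩)) hKc hKD hK0
    have h2 : eLpNorm u (ENNReal.ofReal p) ≤ eLpNorm (u - e k) (ENNReal.ofReal p)
        + eLpNorm (e k) (ENNReal.ofReal p) := by
      simpa using eLpNorm_add_le (hm.sub (hem k)) (hem k) hP
    have h3 : eLpNorm (diffQuot α (u - e k)) (ENNReal.ofReal p) ≤
        eLpNorm (diffQuot α u) (ENNReal.ofReal p)
          + eLpNorm (diffQuot α (e k)) (ENNReal.ofReal p) := by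
      rw [diffQuot_sub]
      exact eLpNorm_sub_le (aestronglyMeasurable_diffQuot_univ α hm)
        (aestronglyMeasurable_diffQuot_univ α (hem k)) hP
    have h4 := (mul_le_mul_right h2 c).trans_eq (mul_add c _ _)
    refine h4.trans ?_
    rw [← add_assoc]
    exact add_le_add (h1.trans h3) le_rfl
  have hlim := (heG.add (ENNReal.Tendsto.const_mul heN (Or.inr hc))).const_add
    (eLpNorm (diffQuot α u) (ENNReal.ofReal p))
  simp only [mul_zero, add_zero] at hlim
  exact ge_of_tendsto hlim key

lemma IsTestFunction.mem_fracSobolevZero {α p : ℝ} (hn : 1 ≤ n) (hp : 1 ≤ p)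
    (hlow : (n : ℝ) < α * p) (hupp : α * p < n + p) {D : Set 𝔼} {φ : 𝔼 → ℝ}
    (hφ : IsTestFunction D φ) : φ ∈ fracSobolevZero (α - n / p) p D := by
  have h0 : diffQuot α (0 : 𝔼 → ℝ) = 0 := by ext; simp [diffQuot]
  exact mem_fracSobolevZero_of_tendsto hp hφ.aestronglyMeasurable hφ.eq_zero (hφ.memLp _).2
    ((eLpNorm_mono_measure _ Measure.restrict_le_self).trans_lt
      (hφ.eLpNorm_diffQuot_lt_top hn hp hlow hupp)) (fun _ => hφ) (by simp) (by simp [h0])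

lemma fracSobolevZero_add_smul {α p : ℝ} (hn : 1 ≤ n) (hp : 1 ≤ p)
    (hlow : (n : ℝ) < α * p) (hupp : α * p < n + p) {D : Set 𝔼} (hD : IsOpen D) {u φ : 𝔼 → ℝ}
    (hu : u ∈ fracSobolevZero (α - n / p) p D) (hφ : IsTestFunction D φ) (t : ℝ) :
    u + t • φ ∈ fracSobolevZero (α - n / p) p D := by
  obtain ⟨hm, h0, hN, hG, ψ, hψ, hψN, hψG⟩ := exists_seq_of_mem_fracSobolevZero hp hD hu
  have hP := one_le_ofReal hp
  have htφ := hφ.const_smul t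
  refine mem_fracSobolevZero_of_tendsto hp (hm.add htφ.aestronglyMeasurable)
    (fun x hx => by simp only [Pi.add_apply, h0 x hx, htφ.eq_zero x hx, add_zero]) ?_ ?_
    (fun k => (hψ k).add htφ) (by simpa using hψN) (by simpa using hψG)
  · exact (eLpNorm_add_le hm htφ.aestronglyMeasurable hP).trans_lt
      (ENNReal.add_lt_top.2 ⟨hN, (htφ.memLp _).2⟩)
  · rw [diffQuot_add]
    exact (eLpNorm_add_le (aestronglyMeasurable_diffQuot_univ α hm).restrict
      (aestronglyMeasurable_diffQuot_univ α htφ.aestronglyMeasurable).restrict hP).trans_lt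
      (ENNReal.add_lt_top.2 ⟨hG, (eLpNorm_mono_measure _ Measure.restrict_le_self).trans_lt
        (htφ.eLpNorm_diffQuot_lt_top hn hp hlow hupp)⟩)

lemma IsTestFunction.not_ae_zero {D : Set 𝔼} {φ : 𝔼 → ℝ} (hφ : IsTestFunction D φ)
    (h : φ ≠ 0) : ¬ φ =ᵐ[volume] 0 := fun h' =>
  h ((Continuous.ae_eq_iff_eq volume hφ.continuous continuous_zero).1 h')

lemma eLpNorm_ofReal_ne_zero {p : ℝ} (hp : 0 < p) {u : 𝔼 → ℝ} (hu : AEStronglyMeasurable u)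
    (h : ¬ u =ᵐ[volume] 0) : eLpNorm u (ENNReal.ofReal p) ≠ 0 := by
  rwa [Ne, eLpNorm_eq_zero_iff hu (by simpa using hp)]

/-- This division-free Poincaré form is linear in the two norms, survives limits and remains
meaningful for the zero function. -/
lemma le_rayleighQuotient_iff {α p : ℝ} (hp : 0 < p) {u : 𝔼 → ℝ} (hu : AEStronglyMeasurable u)
    (hN : eLpNorm u (ENNReal.ofReal p) < ⊤) (h : ¬ u =ᵐ[volume] 0) {c : ℝ≥0∞} :
    c ≤ rayleighQuotient α p u ↔
      c ^ (1 / p) * eLpNorm u (ENNReal.ofReal p) ≤ eLpNorm (diffQuot α u) (ENNReal.ofReal p) := by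
  have h0 := eLpNorm_ofReal_ne_zero hp hu h
  rw [rayleighQuotient_eq hp hu, ENNReal.le_div_iff_mul_le
    (Or.inl (by simp [ENNReal.rpow_eq_zero_iff, h0, hN.ne]))
    (Or.inl (ENNReal.rpow_ne_top_of_nonneg hp.le hN.ne)),
    ← ENNReal.rpow_le_rpow_iff (x := c ^ (1 / p) * _) hp, ENNReal.mul_rpow_of_nonneg _ _ hp.le,
    ← ENNReal.rpow_mul, one_div_mul_cancel hp.ne', ENNReal.rpow_one]

lemma firstEigenvalue_mul_le {α p : ℝ} (hp : 0 < p) {D : Set 𝔼} {φ : 𝔼 → ℝ}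
    (hφ : IsTestFunction D φ) :
    firstEigenvalue α p D ^ (1 / p) * eLpNorm φ (ENNReal.ofReal p) ≤
      eLpNorm (diffQuot α φ) (ENNReal.ofReal p) := by
  by_cases h : φ = 0
  · simp [h]
  · rw [← le_rayleighQuotient_iff hp hφ.aestronglyMeasurable (hφ.memLp _).2 (hφ.not_ae_zero h)]
    exact iInf₂_le_of_le φ hφ (iInf_le _ h)

lemma firstEigenvalue_ne_top {α p : ℝ} (hn : 1 ≤ n) (hp : 1 ≤ p)
    (hlow : (n : ℝ) < α * p) (hupp : α * p < n + p) {D : Set 𝔼} (hD : IsOpen D)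
    (hne : D.Nonempty) : firstEigenvalue α p D ≠ ⊤ := by
  have hp0 : 0 < p := by linarith
  obtain ⟨x, hx⟩ := hne
  obtain ⟨φ, h1, h2, h3, -, h4⟩ := exists_contDiff_tsupport_subset (n := ⊤) (hD.mem_nhds hx)
  have hφ : IsTestFunction D φ := ⟨h3, h2, h1⟩
  have hne : φ ≠ 0 := fun h => by simp [h] at h4
  refine ne_top_of_le_ne_top ?_ (iInf₂_le_of_le φ hφ (iInf_le _ hne))
  rw [rayleighQuotient_eq hp0 hφ.aestronglyMeasurable]
  refine (ENNReal.div_lt_top (ENNReal.rpow_ne_top_of_nonneg hp0.le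
    (hφ.eLpNorm_diffQuot_lt_top hn hp hlow hupp).ne) ?_).ne
  simp [ENNReal.rpow_eq_zero_iff, (hφ.memLp _).2.ne,
    eLpNorm_ofReal_ne_zero hp0 hφ.aestronglyMeasurable (hφ.not_ae_zero hne)]

lemma firstEigenvalue_mul_le_of_mem {α p : ℝ} (hp : 1 ≤ p) {D : Set 𝔼} (hD : IsOpen D)
    (hfin : firstEigenvalue α p D ≠ ⊤) {u : 𝔼 → ℝ}
    (hu : u ∈ fracSobolevZero (α - n / p) p D) :
    firstEigenvalue α p D ^ (1 / p) * eLpNorm u (ENNReal.ofReal p) ≤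
      eLpNorm (diffQuot α u) (ENNReal.ofReal p) :=
  le_diffQuot_of_mem_fracSobolevZero hp hD
    (ENNReal.rpow_ne_top_of_nonneg (by positivity) hfin)
    (fun _ hφ => firstEigenvalue_mul_le (by linarith) hφ) hu

lemma firstEigenvalue_le_rayleighQuotient {α p : ℝ} (hp : 1 ≤ p) {D : Set 𝔼} (hD : IsOpen D)
    (hfin : firstEigenvalue α p D ≠ ⊤) {u : 𝔼 → ℝ}
    (hu : u ∈ fracSobolevZero (α - n / p) p D) (h : ¬ u =ᵐ[volume] 0) :
    firstEigenvalue α p D ≤ rayleighQuotient α p u := by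
  obtain ⟨hm, -, hN, -⟩ := exists_seq_of_mem_fracSobolevZero hp hD hu
  rw [le_rayleighQuotient_iff (by linarith) hm hN h]
  exact firstEigenvalue_mul_le_of_mem hp hD hfin hu

/-- Test functions are competitors, which gives one inequality; the other is the lower bound on all
of W₀^{s,p}. -/
lemma IsRayleighMinimizer.rayleighQuotient_eq {α p : ℝ} (hn : 1 ≤ n) (hp : 1 ≤ p)
    (hlow : (n : ℝ) < α * p) (hupp : α * p < n + p) {D : Set 𝔼} (hD : IsOpen D)
    (hfin : firstEigenvalue α p D ≠ ⊤) {u : 𝔼 → ℝ} (hu : IsRayleighMinimizer α p D u) :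
    rayleighQuotient α p u = firstEigenvalue α p D := by
  refine le_antisymm (le_iInf₂ fun φ hφ => le_iInf fun h => ?_)
    (firstEigenvalue_le_rayleighQuotient hp hD hfin hu.1 hu.2.1)
  exact hu.2.2 φ (hφ.mem_fracSobolevZero hn hp hlow hupp) (hφ.not_ae_zero h)

/-- A minimizer has finite seminorm, and attains equality in the Poincaré inequality. -/
lemma IsRayleighMinimizer.eLpNorm_diffQuot_eq {α p : ℝ} (hn : 1 ≤ n) (hp : 1 ≤ p)
    (hlow : (n : ℝ) < α * p) (hupp : α * p < n + p) {D : Set 𝔼} (hD : IsOpen D)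
    (hfin : firstEigenvalue α p D ≠ ⊤) {u : 𝔼 → ℝ} (hu : IsRayleighMinimizer α p D u) :
    eLpNorm (diffQuot α u) (ENNReal.ofReal p) ^ p =
      firstEigenvalue α p D * eLpNorm u (ENNReal.ofReal p) ^ p := by
  have hp0 : 0 < p := by linarith
  obtain ⟨hm, -, hN, -⟩ := exists_seq_of_mem_fracSobolevZero hp hD hu.1
  have h := hu.rayleighQuotient_eq hn hp hlow hupp hD hfin
  rw [_root_.rayleighQuotient_eq hp0 hm] at h
  have h0 := eLpNorm_ofReal_ne_zero hp0 hm hu.2.1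
  rw [← h, ENNReal.div_mul_cancel]
  · simp [ENNReal.rpow_eq_zero_iff, h0, hN.ne]
  · exact ENNReal.rpow_ne_top_of_nonneg hp0.le hN.ne

lemma IsRayleighMinimizer.eLpNorm_diffQuot_lt_top {α p : ℝ} (hn : 1 ≤ n) (hp : 1 ≤ p)
    (hlow : (n : ℝ) < α * p) (hupp : α * p < n + p) {D : Set 𝔼} (hD : IsOpen D)
    (hfin : firstEigenvalue α p D ≠ ⊤) {u : 𝔼 → ℝ} (hu : IsRayleighMinimizer α p D u) :
    eLpNorm (diffQuot α u) (ENNReal.ofReal p) < ⊤ := by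
  have hp0 : 0 < p := by linarith
  obtain ⟨-, -, hN, -⟩ := exists_seq_of_mem_fracSobolevZero hp hD hu.1
  rw [← ENNReal.rpow_lt_top_iff_of_pos hp0, hu.eLpNorm_diffQuot_eq hn hp hlow hupp hD hfin]
  exact ENNReal.mul_lt_top hfin.lt_top (ENNReal.rpow_lt_top_of_nonneg hp0.le hN.ne)

/-! ### The weak Euler–Lagrange equation -/

lemma abs_rpow_sub_two_mul_le {p : ℝ} (hp : 2 ≤ p) {a b c : ℝ} (ha : |a| ≤ c) (hb : |b| ≤ c) :
    |(|a| ^ (p - 2) * a * b)| ≤ c ^ p := by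
  have hc : 0 ≤ c := (abs_nonneg a).trans ha
  rw [abs_mul, abs_mul, abs_of_nonneg (a := _ ^ (p - 2)) (by positivity)]
  calc |a| ^ (p - 2) * |a| * |b| ≤ c ^ (p - 2) * c * c := by gcongr
    _ = c ^ p := by
      rcases hc.eq_or_lt with rfl | h
      · simp [Real.zero_rpow (show p ≠ 0 by linarith)]
      · rw [mul_assoc, ← sq, ← Real.rpow_natCast c 2, ← Real.rpow_add h]
        congr 1
        push_cast
        ring

lemma integral_abs_rpow_eq {X : Type*} [MeasurableSpace X] {μ : Measure X} {p : ℝ} (hp : 0 < p)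
    {f : X → ℝ} (hf : AEStronglyMeasurable f μ) :
    ∫ x, |f x| ^ p ∂μ = (eLpNorm f (ENNReal.ofReal p) μ ^ p).toReal := by
  have hm : AEMeasurable (fun x => |f x| ^ p) μ := hf.aemeasurable.abs.pow_const p
  rw [integral_eq_lintegral_of_nonneg_ae (ae_of_all _ fun x => by positivity)
    hm.aestronglyMeasurable, eLpNorm_ofReal_rpow hp]
  simp only [enorm_rpow_eq_ofReal hp]

lemma MeasureTheory.MemLp.integrable_abs_rpow {X : Type*} [MeasurableSpace X] {μ : Measure X}
    {p : ℝ} (hp : 0 < p) {f : X → ℝ} (hf : MemLp f (ENNReal.ofReal p) μ) :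
    Integrable (fun x => |f x| ^ p) μ := by
  simpa [ENNReal.toReal_ofReal hp.le] using
    hf.integrable_norm_rpow (by simpa using hp) ENNReal.ofReal_ne_top

lemma hasDerivAt_integral_abs_rpow {X : Type*} [MeasurableSpace X] {μ : Measure X} {p : ℝ}
    (hp : 2 ≤ p) {f g : X → ℝ} (hf : MemLp f (ENNReal.ofReal p) μ)
    (hg : MemLp g (ENNReal.ofReal p) μ) :
    Integrable (fun x => |f x| ^ (p - 2) * f x * g x) μ ∧
    HasDerivAt (fun t : ℝ => ∫ x, |f x + t * g x| ^ p ∂μ)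
      (p * ∫ x, |f x| ^ (p - 2) * f x * g x ∂μ) 0 := by
  have hp0 : 0 < p := by linarith
  have hfm := hf.1.aemeasurable
  have hgm := hg.1.aemeasurable
  have hB : Integrable (fun x => (|f x| + |g x|) ^ p) μ := by
    refine ((hf.abs.add hg.abs).integrable_abs_rpow hp0).congr (ae_of_all _ fun x => ?_)
    have : 0 ≤ |f x| + |g x| := by positivity
    simp [abs_of_nonneg this]
  have hmain : Integrable (fun x => |f x| ^ (p - 2) * f x * g x) μ := by
    refine hB.mono' (by fun_prop) (ae_of_all _ fun x => ?_)
    exact abs_rpow_sub_two_mul_le hp (le_add_of_nonneg_right (abs_nonneg _))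
      (le_add_of_nonneg_left (abs_nonneg _))
  refine ⟨hmain, ?_⟩
  have key := hasDerivAt_integral_of_dominated_loc_of_deriv_le (μ := μ)
    (F := fun t x => |f x + t * g x| ^ p)
    (F' := fun t x => p * |f x + t * g x| ^ (p - 2) * (f x + t * g x) * g x)
    -- For |t| < 1 one has |f + t g| ≤ |f| + |g|, which gives the integrable bound p (|f| + |g|)^p
    -- for the t-derivative.
    (x₀ := (0 : ℝ)) (bound := fun x => p * (|f x| + |g x|) ^ p) (s := Metric.ball 0 1)
    (Metric.ball_mem_nhds _ one_pos)
    (Eventually.of_forall fun t => (((hfm.add (hgm.const_mul t)).abs.pow_const p)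
      ).aestronglyMeasurable)
    (by simpa using hf.integrable_abs_rpow hp0)
    (by fun_prop)
    (ae_of_all _ fun x t ht => by
      have ht' : |t| ≤ 1 := by simpa using (mem_ball_zero_iff.1 ht).le
      have h1 : |f x + t * g x| ≤ |f x| + |g x| := by
        refine (abs_add_le _ _).trans ?_
        rw [abs_mul]
        gcongr
        exact mul_le_of_le_one_left (abs_nonneg _) ht'
      have := abs_rpow_sub_two_mul_le hp h1
        (show |g x| ≤ |f x| + |g x| from le_add_of_nonneg_left (abs_nonneg _))
      rw [mul_assoc, mul_assoc, norm_mul, Real.norm_of_nonneg hp0.le, ← mul_assoc, Real.norm_eq_abs]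
      gcongr)
    (hB.const_mul p)
    (ae_of_all _ fun x t _ => by
      have h1 : HasDerivAt (fun t : ℝ => f x + t * g x) (g x) t := by
        simpa using ((hasDerivAt_id t).mul_const (g x)).const_add (f x)
      exact (hasDerivAt_abs_rpow (f x + t * g x) (by linarith)).comp t h1)
  refine key.2.congr_deriv ?_
  rw [← integral_const_mul]
  refine integral_congr_ae (ae_of_all _ fun x => ?_)
  simp only [zero_mul, add_zero]
  ring

lemma abs_diffQuot_rpow_mul (α p : ℝ) (u φ : 𝔼 → ℝ) (z : 𝔼 × 𝔼) :
    |diffQuot α u z| ^ (p - 2) * diffQuot α u z * diffQuot α φ z =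
      |u z.2 - u z.1| ^ (p - 2) * (u z.2 - u z.1) * (φ z.2 - φ z.1) / ‖z.2 - z.1‖ ^ (α * p) := by
  rcases eq_or_ne z.2 z.1 with h | h
  · simp [diffQuot, h]
  have hr : 0 < ‖z.2 - z.1‖ := norm_pos_iff.2 (sub_ne_zero.2 h)
  have e : ‖z.2 - z.1‖ ^ (α * p) =
      ‖z.2 - z.1‖ ^ (α * (p - 2)) * ‖z.2 - z.1‖ ^ α * ‖z.2 - z.1‖ ^ α := by
    rw [← Real.rpow_add hr, ← Real.rpow_add hr]; congr 1; ring
  rw [abs_diffQuot_rpow, e, diffQuot, diffQuot]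
  ring

lemma IsRayleighMinimizer.satisfiesEulerLagrange {α p : ℝ} (hn : 1 ≤ n) (hp : 2 ≤ p)
    (hlow : (n : ℝ) < α * p) (hupp : α * p < n + p) {D : Set 𝔼} (hD : IsOpen D)
    (hfin : firstEigenvalue α p D ≠ ⊤) {u : 𝔼 → ℝ} (hu : IsRayleighMinimizer α p D u) :
    SatisfiesEulerLagrange α p D (firstEigenvalue α p D).toReal u := by
  have hp0 : 0 < p := by linarith
  have hp1 : 1 ≤ p := by linarith
  intro φ hφ
  obtain ⟨hm, -, hN, -⟩ := exists_seq_of_mem_fracSobolevZero hp1 hD hu.1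
  have hφG := hφ.eLpNorm_diffQuot_lt_top hn hp1 hlow hupp
  have hφD := aestronglyMeasurable_diffQuot_univ α hφ.aestronglyMeasurable
  have hDm := aestronglyMeasurable_diffQuot_univ α hm
  have heq := hu.eLpNorm_diffQuot_eq hn hp1 hlow hupp hD hfin
  have hG := hu.eLpNorm_diffQuot_lt_top hn hp1 hlow hupp hD hfin
  have hMu : MemLp (diffQuot α u) (ENNReal.ofReal p) volume := ⟨hDm, hG⟩
  have hMφ : MemLp (diffQuot α φ) (ENNReal.ofReal p) volume := ⟨hφD, hφG⟩
  obtain ⟨hI1, hd1⟩ := hasDerivAt_integral_abs_rpow hp hMu hMφ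
  obtain ⟨hI2, hd2⟩ := hasDerivAt_integral_abs_rpow hp (μ := volume) ⟨hm, hN⟩ (hφ.memLp _)
  simp only [abs_diffQuot_rpow_mul] at hI1 hd1
  refine ⟨hI1, hI2, ?_⟩
  set lam := (firstEigenvalue α p D).toReal
  have hle : ∀ t : ℝ, lam * ∫ x, |u x + t * φ x| ^ p ≤
      ∫ z, |diffQuot α u z + t * diffQuot α φ z| ^ p := by
    intro t
    have h1 := firstEigenvalue_mul_le_of_mem hp1 hD hfin
      (fracSobolevZero_add_smul hn hp1 hlow hupp hD hu.1 hφ t)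
    rw [diffQuot_add, diffQuot_smul] at h1
    have h2 := ENNReal.rpow_le_rpow h1 hp0.le
    rw [ENNReal.mul_rpow_of_nonneg _ _ hp0.le, ← ENNReal.rpow_mul, one_div_mul_cancel hp0.ne',
      ENNReal.rpow_one] at h2
    have h3 : eLpNorm (diffQuot α u + t • diffQuot α φ) (ENNReal.ofReal p) < ⊤ :=
      (hMu.add (hMφ.const_smul t)).2
    have h4 := ENNReal.toReal_mono (ENNReal.rpow_ne_top_of_nonneg hp0.le h3.ne) h2
    rw [ENNReal.toReal_mul,
      ← integral_abs_rpow_eq hp0 (hm.add (hφ.const_smul t).aestronglyMeasurable),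
      ← integral_abs_rpow_eq hp0 (hDm.add (hφD.const_smul t))] at h4
    simpa using h4
  have h0 : lam * ∫ x, |u x| ^ p = ∫ z, |diffQuot α u z| ^ p := by
    rw [integral_abs_rpow_eq hp0 hm, integral_abs_rpow_eq hp0 hDm, heq, ENNReal.toReal_mul]
  -- By `hle` and `h0` this function is nonnegative and zero at t = 0, so no quotient has to be
  -- differentiated.
  have hmin : IsLocalMin (fun t : ℝ => (∫ z, |diffQuot α u z + t * diffQuot α φ z| ^ p)
      - lam * ∫ x, |u x + t * φ x| ^ p) 0 :=
    Eventually.of_forall fun t => by simpa [h0] using hle t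
  have hz := hmin.hasDerivAt_eq_zero (hd1.sub (hd2.const_mul lam))
  have : p * ((∫ z : 𝔼 × 𝔼, |u z.2 - u z.1| ^ (p - 2) * (u z.2 - u z.1) * (φ z.2 - φ z.1)
      / ‖z.2 - z.1‖ ^ (α * p)) - lam * ∫ x, |u x| ^ (p - 2) * u x * φ x) = 0 := by
    rw [← hz]; ring
  exact sub_eq_zero.1 ((mul_eq_zero.1 this).resolve_left hp0.ne')

/-! ### Hölder continuity -/

/-- Averages over two bounded sets are comparable through the Gagliardo seminorm. -/
lemma abs_average_sub_average_le {α p : ℝ} (hα : 0 ≤ α) (hp : 1 ≤ p) {u : 𝔼 → ℝ}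
    (hu : MemLp u (ENNReal.ofReal p)) (hG : eLpNorm (diffQuot α u) (ENNReal.ofReal p) < ⊤)
    {A B : Set 𝔼} (hA : MeasurableSet A) (hB : MeasurableSet B)
    (hA0 : 0 < volume.real A) (hB0 : 0 < volume.real B) {R : ℝ}
    (hR : ∀ x ∈ A, ∀ y ∈ B, ‖y - x‖ ≤ R) :
    |(⨍ x in A, u x) - ⨍ y in B, u y| ≤
      R ^ α * (eLpNorm (diffQuot α u) (ENNReal.ofReal p)).toReal
        * (volume.real A * volume.real B) ^ (-(1 / p)) := by
  have hp0 : 0 < p := by linarith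
  have hP := one_le_ofReal hp
  have hAt : volume A ≠ ⊤ := fun h => by simp [Measure.real, h] at hA0
  have hBt : volume B ≠ ⊤ := fun h => by simp [Measure.real, h] at hB0
  have : IsFiniteMeasure (volume.restrict A) := ⟨by simpa using hAt.lt_top⟩
  have : IsFiniteMeasure (volume.restrict B) := ⟨by simpa using hBt.lt_top⟩
  set ν : Measure (𝔼 × 𝔼) := (volume.restrict A).prod (volume.restrict B) with hν
  have hν' : ν = volume.restrict (A ×ˢ B) := by
    rw [hν, Measure.prod_restrict, Measure.volume_eq_prod]
  have huA : Integrable u (volume.restrict A) := (hu.restrict A).integrable hP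
  have huB : Integrable u (volume.restrict B) := (hu.restrict B).integrable hP
  set V := volume.real A * volume.real B
  have hV : 0 < V := mul_pos hA0 hB0
  have hνV : ν univ = ENNReal.ofReal V := by
    rw [hν', Measure.restrict_apply_univ, Measure.volume_eq_prod, Measure.prod_prod,
      ENNReal.ofReal_mul hA0.le, ofReal_measureReal hAt, ofReal_measureReal hBt]
  have hdiff : (⨍ x in A, u x) - ⨍ y in B, u y = V⁻¹ * ∫ z, (u z.1 - u z.2) ∂ν := by
    rw [integral_sub (huA.comp_fst _) (huB.comp_snd _), integral_fun_fst, integral_fun_snd,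
      setAverage_eq, setAverage_eq]
    simp only [smul_eq_mul, measureReal_restrict_apply_univ, V]
    field_simp
  have hDm : AEStronglyMeasurable (diffQuot α u) ν := by
    rw [hν']; exact (aestronglyMeasurable_diffQuot_univ α hu.1).restrict
  -- On A × B the increment of u is at most R^α times the difference quotient. Hölder on a set of
  -- measure V costs V^(1 - 1/p), and the division by V in `hdiff` leaves V^(-1/p).
  have hbd : ‖∫ z, (u z.1 - u z.2) ∂ν‖ₑ ≤ ENNReal.ofReal (R ^ α) *
      (eLpNorm (diffQuot α u) (ENNReal.ofReal p) * ENNReal.ofReal V ^ (1 - 1 / p)) := by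
    calc ‖∫ z, (u z.1 - u z.2) ∂ν‖ₑ ≤ ∫⁻ z, ‖u z.1 - u z.2‖ₑ ∂ν :=
          enorm_integral_le_lintegral_enorm _
      _ ≤ ∫⁻ z, ENNReal.ofReal (R ^ α) * ‖diffQuot α u z‖ₑ ∂ν := by
          refine lintegral_mono_ae ?_
          rw [hν']
          filter_upwards [ae_restrict_mem (hA.prod hB)] with z hz
          have hzR := hR z.1 hz.1 z.2 hz.2
          rw [Real.enorm_eq_ofReal_abs, Real.enorm_eq_ofReal_abs,
            ← ENNReal.ofReal_mul (Real.rpow_nonneg ((norm_nonneg _).trans hzR) _)]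
          apply ENNReal.ofReal_le_ofReal
          rw [abs_diffQuot, abs_sub_comm]
          rcases eq_or_ne z.2 z.1 with h | h
          · simp [h]
          have hr : 0 < ‖z.2 - z.1‖ := norm_pos_iff.2 (sub_ne_zero.2 h)
          rw [mul_div_assoc', le_div_iff₀ (by positivity), mul_comm]
          gcongr
      _ = ENNReal.ofReal (R ^ α) * eLpNorm (diffQuot α u) 1 ν := by
          rw [lintegral_const_mul'' _ hDm.enorm, eLpNorm_one_eq_lintegral_enorm]
      _ ≤ _ := by
          gcongr
          refine (eLpNorm_le_eLpNorm_mul_rpow_measure_univ hP hDm).trans ?_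
          rw [hνV, ENNReal.toReal_one, ENNReal.toReal_ofReal hp0.le, div_one]
          gcongr
          rw [hν']
          exact Measure.restrict_le_self
  have hVr : ENNReal.ofReal V ^ (1 - 1 / p) = ENNReal.ofReal (V ^ (1 - 1 / p)) :=
    ENNReal.ofReal_rpow_of_pos hV
  have hbd' := ENNReal.toReal_mono (by
    rw [hVr]
    exact ENNReal.mul_ne_top ENNReal.ofReal_ne_top
      (ENNReal.mul_ne_top hG.ne ENNReal.ofReal_ne_top)) hbd
  have hR0 : 0 ≤ R := by
    have hne : ∀ S : Set 𝔼, 0 < volume.real S → S.Nonempty := fun S hS => by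
      by_contra h
      rw [not_nonempty_iff_eq_empty] at h
      simp [h] at hS
    obtain ⟨x, hx⟩ := hne A hA0
    obtain ⟨y, hy⟩ := hne B hB0
    exact (norm_nonneg _).trans (hR x hx y hy)
  rw [hVr, toReal_enorm, Real.norm_eq_abs, ENNReal.toReal_mul, ENNReal.toReal_mul,
    ENNReal.toReal_ofReal (by positivity), ENNReal.toReal_ofReal (by positivity)] at hbd'
  rw [hdiff, abs_mul, abs_of_pos (inv_pos.2 hV)]
  calc V⁻¹ * |∫ z, (u z.1 - u z.2) ∂ν| ≤ V⁻¹ * (R ^ α *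
        ((eLpNorm (diffQuot α u) (ENNReal.ofReal p)).toReal * V ^ (1 - 1 / p))) := by gcongr
    _ = _ := by
      rw [Real.rpow_sub hV, Real.rpow_one, Real.rpow_neg hV.le]
      field_simp

/-- The product of the two volumes is of order r^(2n), whence the exponent α - 2n/p. Allowing r/2 ≤
ρ ≤ r serves both uses: halving the radius at a fixed centre, and moving the centre at a fixed
radius. -/
lemma exists_abs_average_closedBall_sub_le {α p : ℝ} (hα : 0 ≤ α) (hp : 1 ≤ p) :
    ∃ C : ℝ, 0 ≤ C ∧ ∀ u : 𝔼 → ℝ, MemLp u (ENNReal.ofReal p) →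
      eLpNorm (diffQuot α u) (ENNReal.ofReal p) < ⊤ → ∀ (x y : 𝔼) (r ρ : ℝ), 0 < r →
      r / 2 ≤ ρ → ρ ≤ r → dist x y ≤ r →
      |(⨍ a in Metric.closedBall x r, u a) - ⨍ b in Metric.closedBall y ρ, u b| ≤
        C * (eLpNorm (diffQuot α u) (ENNReal.ofReal p)).toReal * r ^ (α - 2 * n / p) := by
  set κ : ℝ := volume.real (Metric.closedBall (0 : 𝔼) 1)
  have hκ : 0 < κ := ENNReal.toReal_pos
    (Metric.measure_closedBall_pos _ _ one_pos).ne' measure_closedBall_lt_top.ne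
  -- Points of the two balls are at distance at most ρ + r + r ≤ 3r; the factor 2⁻¹ ^ n comes from ρ
  -- ≥ r/2, and κ is the volume of the unit ball.
  refine ⟨3 ^ α * (κ * κ * 2⁻¹ ^ n) ^ (-(1 / p)), by positivity,
    fun u hu hG x y r ρ hr hρ hρr hxy => ?_⟩
  have hρ0 : 0 < ρ := by linarith
  have hvol : ∀ (x : 𝔼) {s : ℝ}, 0 ≤ s → volume.real (Metric.closedBall x s) = s ^ n * κ := by
    intro x s hs
    rw [Measure.addHaar_real_closedBall' _ _ hs, finrank_euclideanSpace_fin]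
  have h := abs_average_sub_average_le hα hp hu hG (A := Metric.closedBall x r)
    (B := Metric.closedBall y ρ) Metric.isClosed_closedBall.measurableSet
    Metric.isClosed_closedBall.measurableSet (by rw [hvol x hr.le]; positivity)
    (by rw [hvol y hρ0.le]; positivity) (R := 3 * r) (fun a ha b hb => by
      rw [← dist_eq_norm]
      have h1 := Metric.mem_closedBall.1 ha
      have h2 := Metric.mem_closedBall.1 hb
      have h3 := dist_triangle4 b y x a
      rw [dist_comm x a, dist_comm y x] at h3
      linarith)
  refine h.trans ?_
  rw [hvol x hr.le, hvol y hρ0.le]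
  have hp0 : 0 < p := by linarith
  have e1 : (r ^ n * κ * (ρ ^ n * κ)) ^ (-(1 / p)) ≤
      (κ * κ * 2⁻¹ ^ n) ^ (-(1 / p)) * r ^ (-(2 * n / p)) := by
    have : r ^ (-(2 * n / p)) = (r ^ n * r ^ n) ^ (-(1 / p)) := by
      rw [← pow_add, ← Real.rpow_natCast, ← Real.rpow_mul hr.le]
      congr 1
      push_cast
      ring
    rw [this, ← Real.mul_rpow (by positivity) (by positivity)]
    apply Real.rpow_le_rpow_of_nonpos (by positivity) _ (by simp [hp0.le])
    calc κ * κ * 2⁻¹ ^ n * (r ^ n * r ^ n) = r ^ n * κ * ((r / 2) ^ n * κ) := by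
          rw [div_pow, inv_pow]; ring
      _ ≤ _ := by gcongr
  have e2 : (3 * r) ^ α = 3 ^ α * r ^ α := Real.mul_rpow (by norm_num) hr.le
  have e3 : r ^ (α - 2 * n / p) = r ^ α * r ^ (-(2 * n / p)) := by
    rw [← Real.rpow_add hr, sub_eq_add_neg]
  rw [e2, e3]
  set g := (eLpNorm (diffQuot α u) (ENNReal.ofReal p)).toReal
  have hg : 0 ≤ g := ENNReal.toReal_nonneg
  calc _ ≤ 3 ^ α * r ^ α * g * ((κ * κ * 2⁻¹ ^ n) ^ (-(1 / p)) * r ^ (-(2 * n / p))) := by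
        gcongr
    _ = _ := by ring

/-- A Hölder continuous function on a dense set extends to the whole space. -/
lemma exists_holder_extension {X : Type*} [PseudoMetricSpace X] {S : Set X} (hS : Dense S)
    {f : X → ℝ} {K β : ℝ} (hβ : 0 < β)
    (h : ∀ x ∈ S, ∀ y ∈ S, |f x - f y| ≤ K * dist x y ^ β) :
    ∃ v : X → ℝ, Continuous v ∧ (∀ x ∈ S, v x = f x) ∧
      ∀ x y, |v x - v y| ≤ K * dist x y ^ β := by
  have hu : UniformContinuous (fun s : S => f s) := by
    rw [Metric.uniformContinuous_iff]
    intro ε hε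
    have hc : Continuous fun t : ℝ => K * t ^ β :=
      continuous_const.mul (Real.continuous_rpow_const hβ.le)
    have ht := hc.tendsto 0
    rw [Real.zero_rpow hβ.ne', mul_zero] at ht
    obtain ⟨δ, hδ, hδ'⟩ := Metric.eventually_nhds_iff.1 (ht.eventually (gt_mem_nhds hε))
    refine ⟨δ, hδ, fun {a b} hab => (h a a.2 b b.2).trans_lt (hδ' ?_)⟩
    simpa [Real.dist_eq, abs_of_nonneg dist_nonneg, Subtype.dist_eq] using hab
  have hi : IsUniformInducing ((↑) : S → X) := isUniformInducing_val S
  have hd : DenseRange ((↑) : S → X) := hS.denseRange_val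
  have hv := (uniformContinuous_uniformly_extend hi hd hu).continuous
  have hvS := uniformly_extend_of_ind hi hd hu
  set v := (hi.isDenseInducing hd).extend fun s : S => f s
  refine ⟨v, hv, fun x hx => hvS ⟨x, hx⟩, fun x y => ?_⟩
  refine isClosed_property2 (p := fun x y => |v x - v y| ≤ K * dist x y ^ β) hd ?_ ?_ x y
  · refine isClosed_le (by fun_prop) (continuous_const.mul ?_)
    exact (Real.continuous_rpow_const hβ.le).comp continuous_dist
  · intro a b
    rw [hvS, hvS]
    exact h a a.2 b b.2

/-- Campanato's argument: at a Lebesgue point, means over balls with halved radii converge to u x at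
the geometric rate q = 2^(-β). Comparing two Lebesgue points at radius `dist x y` gives the Hölder
bound on a set of full measure, which is dense, and the function extends. -/
lemma exists_holder_representative {α p : ℝ} (hα : 0 ≤ α) (hp : 1 ≤ p)
    (hβ : 0 < α - 2 * n / p) :
    ∃ C : ℝ, 0 ≤ C ∧ ∀ u : 𝔼 → ℝ, MemLp u (ENNReal.ofReal p) →
      eLpNorm (diffQuot α u) (ENNReal.ofReal p) < ⊤ →
      ∃ v : 𝔼 → ℝ, Continuous v ∧ v =ᵐ[volume] u ∧ ∀ x y,
        |v x - v y| ≤ C * (eLpNorm (diffQuot α u) (ENNReal.ofReal p)).toReal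
          * dist x y ^ (α - 2 * n / p) := by
  obtain ⟨C, hC, h⟩ := exists_abs_average_closedBall_sub_le (n := n) hα hp
  set β := α - 2 * n / p
  set q : ℝ := 2⁻¹ ^ β
  have hq : q < 1 := Real.rpow_lt_one (by norm_num) (by norm_num) hβ
  have hq' : 0 < 1 - q := by linarith
  -- The outer terms are the geometric series at x and at y; the middle one compares the two balls
  -- of radius `dist x y`.
  refine ⟨C / (1 - q) + C + C / (1 - q), by positivity, fun u hu hG => ?_⟩
  set g := (eLpNorm (diffQuot α u) (ENNReal.ofReal p)).toReal
  have hl : LocallyIntegrable u := hu.locallyIntegrable (one_le_ofReal hp)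
  set S : Set 𝔼 := {x | Tendsto (fun r => ⨍ y in Metric.closedBall x r, u y) (𝓝[>] 0) (𝓝 (u x))}
  have hS : ∀ᵐ x, x ∈ S := by
    filter_upwards [(Besicovitch.vitaliFamily (volume : Measure 𝔼)).ae_tendsto_average hl] with x hx
    exact hx.comp (Besicovitch.tendsto_filterAt volume x)
  have hlim : ∀ x ∈ S, ∀ r, 0 < r →
      |(⨍ y in Metric.closedBall x r, u y) - u x| ≤ C * g * r ^ β / (1 - q) := by
    intro x hx r hr
    have hr2 : Tendsto (fun k : ℕ => r * 2⁻¹ ^ k) atTop (𝓝[>] 0) := by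
      refine tendsto_nhdsWithin_iff.2 ⟨?_, Eventually.of_forall fun k => ?_⟩
      · simpa using (tendsto_pow_atTop_nhds_zero_of_lt_one (r := (2⁻¹ : ℝ)) (by norm_num)
          (by norm_num)).const_mul r
      · simp only [mem_Ioi]; positivity
    have := dist_le_of_le_geometric_of_tendsto₀ (f := fun k : ℕ =>
      ⨍ y in Metric.closedBall x (r * 2⁻¹ ^ k), u y) q (C * g * r ^ β) hq (fun k => ?_)
      (Tendsto.comp hx hr2)
    · simpa [Real.dist_eq] using this
    · have hk : r * 2⁻¹ ^ (k + 1) = r * 2⁻¹ ^ k / 2 := by rw [pow_succ]; ring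
      have hk0 : 0 < r * 2⁻¹ ^ k := by positivity
      rw [Real.dist_eq]
      refine (h u hu hG x x (r * 2⁻¹ ^ k) (r * 2⁻¹ ^ (k + 1)) hk0 hk.ge
        (by rw [hk]; linarith) (by simpa using hk0.le)).trans_eq ?_
      rw [Real.mul_rpow hr.le (by positivity), ← Real.rpow_pow_comm (by norm_num)]
      ring
  have hSh : ∀ x ∈ S, ∀ y ∈ S,
      |u x - u y| ≤ (C / (1 - q) + C + C / (1 - q)) * g * dist x y ^ β := by
    intro x hx y hy
    rcases (dist_nonneg (x := x) (y := y)).eq_or_lt with h0 | h0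
    · rw [dist_eq_zero.1 h0.symm]; simp [Real.zero_rpow hβ.ne']
    have h1 := hlim x hx _ h0
    have h2 := hlim y hy _ h0
    have h3 := h u hu hG x y _ _ h0 (by linarith) le_rfl le_rfl
    rw [abs_sub_comm] at h1
    have := (abs_add_three _ _ _).trans (add_le_add (add_le_add h1 h3) h2)
    rw [sub_add_sub_cancel, sub_add_sub_cancel] at this
    refine this.trans_eq ?_
    ring
  obtain ⟨v, hv, hvS, hvh⟩ := exists_holder_extension (Measure.dense_of_ae hS) hβ hSh
  refine ⟨v, hv, ?_, hvh⟩
  filter_upwards [hS] with x hx using hvS x hx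

/-- For large `α p`, a member of `W₀^{s,p}(D)` of finite energy has a Hölder continuous
representative vanishing at every point outside `D`. -/
lemma exists_memHolderSpace {α p : ℝ} (hn : 1 ≤ n) (hp : 1 ≤ p) (hlow : 2 * (n : ℝ) < α * p)
    {D : Set 𝔼} (hD : IsOpen D) (hDb : Bornology.IsBounded D) {u : 𝔼 → ℝ}
    (hu : u ∈ fracSobolevZero (α - n / p) p D)
    (hG : eLpNorm (diffQuot α u) (ENNReal.ofReal p) < ⊤) :
    ∃ v : 𝔼 → ℝ, v =ᵐ[volume] u ∧ (∀ x, x ∉ D → v x = 0) ∧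
      MemHolderSpace (α - 2 * n / p) v := by
  have hp0 : 0 < p := by linarith
  have hβ : 0 < α - 2 * n / p := by rw [sub_pos, div_lt_iff₀ hp0]; exact hlow
  have hα : 0 ≤ α := by
    have : (0 : ℝ) ≤ 2 * n / p := by positivity
    linarith
  obtain ⟨C, hC, hrep⟩ := exists_holder_representative (n := n) hα hp hβ
  obtain ⟨hm, h0, hN, -⟩ := exists_seq_of_mem_fracSobolevZero hp hD hu
  obtain ⟨e, hem, he0, hK, heN, heG⟩ := exists_compact_support_approx hp hD hu hG
  obtain ⟨v, hv, hvu, hvh⟩ := hrep u ⟨hm, hN⟩ hG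
  have : Nonempty (Fin n) := ⟨⟨0, hn⟩⟩
  obtain ⟨y, hy⟩ : ∃ y, y ∉ closure D := by
    by_contra! h
    exact NormedSpace.unbounded_univ ℝ 𝔼 (hDb.closure.subset fun x _ => h x)
  -- The identity v = u almost everywhere need not determine v at boundary points. Since u = e k off
  -- a compact K ⊆ D, the continuous representatives v of u and z of e k agree on the open
  -- complement of K, while z y = 0. Hence |v x| = |z x - z y|, which is at most C [e k] `dist x y`
  -- ^ β and tends to zero.
  have hvan : ∀ x, x ∉ D → v x = 0 := by
    intro x hx
    have key : ∀ᶠ k in atTop, |v x| ≤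
        C * (eLpNorm (diffQuot α (e k)) (ENNReal.ofReal p)).toReal
          * dist x y ^ (α - 2 * n / p) := by
      filter_upwards [heN.eventually (gt_mem_nhds zero_lt_one),
        heG.eventually (gt_mem_nhds zero_lt_one)] with k hk1 hk2
      obtain ⟨z, hz, hze, hzh⟩ := hrep (e k) ⟨hem k, hk1.trans ENNReal.one_lt_top⟩
        (hk2.trans ENNReal.one_lt_top)
      obtain ⟨K, hKD, hKc, hK0⟩ := hK k
      have h1 : EqOn v z Kᶜ := by
        refine Measure.eqOn_open_of_ae_eq (μ := volume) ?_ hKc.isClosed.isOpen_compl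
          hv.continuousOn hz.continuousOn
        filter_upwards [ae_restrict_of_ae hvu, ae_restrict_of_ae hze,
          ae_restrict_mem hKc.measurableSet.compl] with a ha1 ha2 ha3
        rw [ha1, ha2]
        exact sub_eq_zero.1 (hK0 a ha3)
      have h2 : EqOn z 0 (closure D)ᶜ := by
        refine Measure.eqOn_open_of_ae_eq (μ := volume) ?_ isClosed_closure.isOpen_compl
          hz.continuousOn continuousOn_const
        filter_upwards [ae_restrict_of_ae hze,
          ae_restrict_mem isClosed_closure.measurableSet.compl] with a ha2 ha3
        rw [ha2]
        exact he0 k a fun h => ha3 (subset_closure h)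
      have h3 := hzh x y
      rwa [h2 hy, Pi.zero_apply, sub_zero, ← h1 fun h => hx (hKD h)] at h3
    have hlim : Tendsto (fun k => C * (eLpNorm (diffQuot α (e k)) (ENNReal.ofReal p)).toReal
        * dist x y ^ (α - 2 * n / p)) atTop (𝓝 0) := by
      have := (ENNReal.tendsto_toReal ENNReal.zero_ne_top).comp heG
      simpa [Function.comp_def] using (this.const_mul C).mul_const (dist x y ^ (α - 2 * n / p))
    exact abs_nonpos_iff.1 (ge_of_tendsto hlim key)
  refine ⟨v, hvu, hvan, ?_, _, fun x x' => by rw [← dist_eq_norm]; exact hvh x x'⟩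
  obtain ⟨R, hR⟩ := hDb.subset_closedBall y
  set g := (eLpNorm (diffQuot α u) (ENNReal.ofReal p)).toReal
  have hg : 0 ≤ g := ENNReal.toReal_nonneg
  refine ⟨C * g * |R| ^ (α - 2 * n / p), fun x => ?_⟩
  by_cases hx : x ∈ D
  · have h1 := hvh x y
    rw [hvan y fun h => hy (subset_closure h), sub_zero] at h1
    refine h1.trans ?_
    gcongr
    exact (Metric.mem_closedBall.1 (hR hx)).trans (le_abs_self R)
  · rw [hvan x hx, abs_zero]; positivity

/-! ### Compactness: averages over the cells of a cubic lattice -/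

/-- The index of the cell of side length `1 / m` that contains a given point. -/
noncomputable def cellIndex (m : ℕ) (x : 𝔼) : Fin n → ℤ := fun i => ⌊(m : ℝ) * x i⌋

/-- The half-open cube of side length `1 / m` with a given index. -/
def cell (m : ℕ) (j : Fin n → ℤ) : Set 𝔼 := {x | cellIndex m x = j}

lemma measurable_cellIndex (m : ℕ) : Measurable (cellIndex m : 𝔼 → Fin n → ℤ) := by
  refine measurable_pi_lambda _ fun i => ?_
  exact Int.measurable_floor.comp (by fun_prop)

lemma measurableSet_cell (m : ℕ) (j : Fin n → ℤ) : MeasurableSet (cell m j : Set 𝔼) :=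
  measurable_cellIndex m (measurableSet_singleton j)

lemma volume_cell {m : ℕ} (hm : 0 < m) (j : Fin n → ℤ) :
    volume (cell m j : Set 𝔼) = ((m : ℝ≥0∞) ^ n)⁻¹ := by
  have hm' : (0 : ℝ) < m := by exact_mod_cast hm
  have h : (cell m j : Set 𝔼) = (WithLp.ofLp : 𝔼 → Fin n → ℝ) ⁻¹'
      (univ.pi fun i => Ico ((j i : ℝ) / m) ((j i + 1) / m)) := by
    ext x
    simp only [cell, cellIndex, mem_ofPred_eq, funext_iff, mem_preimage, mem_univ_pi, mem_Ico,
      Int.floor_eq_iff, div_le_iff₀ hm', lt_div_iff₀ hm']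
    refine forall_congr' fun i => ?_
    rw [mul_comm]
  rw [h, (PiLp.volume_preserving_ofLp (Fin n)).measure_preimage
    (MeasurableSet.univ_pi fun i => measurableSet_Ico).nullMeasurableSet, Real.volume_pi_Ico]
  have : ∀ i, ((j i : ℝ) + 1) / m - j i / m = (m : ℝ)⁻¹ := fun i => by ring
  simp only [this, Finset.prod_const, Finset.card_univ, Fintype.card_fin]
  rw [ENNReal.ofReal_inv_of_pos hm', ENNReal.ofReal_natCast, ENNReal.inv_pow]

lemma norm_sub_le_of_mem_cell {m : ℕ} (hm : 0 < m) {j : Fin n → ℤ} {x y : 𝔼} (hx : x ∈ cell m j)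
    (hy : y ∈ cell m j) : ‖y - x‖ ≤ √n / m := by
  have hm' : (0 : ℝ) < m := by exact_mod_cast hm
  have hi : ∀ i, ‖(y - x) i‖ ^ 2 ≤ (1 / (m : ℝ)) ^ 2 := by
    intro i
    have h1 : ⌊(m : ℝ) * x i⌋ = ⌊(m : ℝ) * y i⌋ :=
      (congrFun hx i).trans (congrFun hy i).symm
    have h2 := Int.abs_sub_lt_one_of_floor_eq_floor h1
    rw [← mul_sub, abs_mul, abs_of_pos hm', abs_sub_comm] at h2
    have h3 : |y i - x i| ≤ 1 / m := by
      rw [le_div_iff₀ hm', mul_comm]; exact h2.le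
    rw [Real.norm_eq_abs]
    exact pow_le_pow_left₀ (abs_nonneg _) h3 2
  rw [EuclideanSpace.norm_eq, Real.sqrt_le_left (by positivity)]
  refine (Finset.sum_le_sum fun i _ => hi i).trans_eq ?_
  rw [Finset.sum_const, Finset.card_univ, Fintype.card_fin, nsmul_eq_mul, div_pow, div_pow,
    Real.sq_sqrt (Nat.cast_nonneg n)]
  ring

/-- The average of a function over the cell that contains a given point. -/
noncomputable def cellAverage (m : ℕ) (u : 𝔼 → ℝ) (x : 𝔼) : ℝ := ⨍ y in cell m (cellIndex m x), u y

/-- Jensen's inequality for the average over a cell. -/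
lemma enorm_average_cell_rpow_le {m : ℕ} (hm : 0 < m) {p : ℝ} (hp : 1 ≤ p) {f : 𝔼 → ℝ}
    (hf : AEStronglyMeasurable f) (j : Fin n → ℤ) :
    ‖⨍ y in cell m j, f y‖ₑ ^ p ≤ (m : ℝ≥0∞) ^ n * ∫⁻ y in cell m j, ‖f y‖ₑ ^ p := by
  have hv := volume_cell hm j
  have hm' : (m : ℝ≥0∞) ^ n ≠ 0 := by simp [hm.ne']
  have hmt : (m : ℝ≥0∞) ^ n ≠ ⊤ := ENNReal.pow_ne_top (ENNReal.natCast_ne_top m)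
  set ν : Measure 𝔼 := (m : ℝ≥0∞) ^ n • volume.restrict (cell m j) with hν
  have : IsProbabilityMeasure ν := ⟨by
    simp [ν, hv, ENNReal.mul_inv_cancel hm' hmt]⟩
  have hav : ⨍ y in cell m j, f y = ∫ y, f y ∂ν := by
    rw [average, Measure.restrict_apply_univ, hv, inv_inv]
  have hfν : AEStronglyMeasurable f ν := hf.restrict.smul_measure _
  rw [hav, ← smul_eq_mul, ← lintegral_smul_measure]
  exact (ENNReal.rpow_le_rpow (enorm_integral_le_lintegral_enorm _) (by linarith)).trans
    (enorm_integral_rpow_le hp hfν)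

/-- Jensen bounds |u x - average|^p by m^n, the reciprocal cell volume, times the integral of |u x -
u y|^p over the cell. There ‖y - x‖ ≤ √n / m, so each increment costs (√n / m)^(αp) against the
difference quotient. -/
lemma eLpNorm_sub_cellAverage_le {m : ℕ} (hm : 0 < m) {α p : ℝ} (hα : 0 ≤ α) (hp : 1 ≤ p)
    {u : 𝔼 → ℝ} (hu : MemLp u (ENNReal.ofReal p)) :
    eLpNorm (u - cellAverage m u) (ENNReal.ofReal p) ^ p ≤
      ENNReal.ofReal ((m : ℝ) ^ n * (√n / m) ^ (α * p))
        * eLpNorm (diffQuot α u) (ENNReal.ofReal p) ^ p := by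
  have hp0 : 0 < p := by linarith
  have hDm := (aestronglyMeasurable_diffQuot_univ α hu.1).enorm.pow_const p
  set R : ℝ := √n / m
  have hR : 0 ≤ R := by positivity
  have hpt : ∀ x, ‖(u - cellAverage m u) x‖ₑ ^ p ≤ ENNReal.ofReal ((m : ℝ) ^ n * R ^ (α * p)) *
      ∫⁻ y, ‖diffQuot α u (x, y)‖ₑ ^ p := by
    intro x
    have hfin : volume (cell m (cellIndex m x) : Set 𝔼) ≠ ⊤ := by
      rw [volume_cell hm]
      simp [hm.ne']
    have hpos : volume (cell m (cellIndex m x) : Set 𝔼) ≠ 0 := by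
      rw [volume_cell hm]
      simp [ENNReal.pow_eq_top_iff]
    have : IsFiniteMeasure (volume.restrict (cell m (cellIndex m x) : Set 𝔼)) :=
      ⟨by simpa using hfin.lt_top⟩
    have : NeZero (volume.restrict (cell m (cellIndex m x) : Set 𝔼)) :=
      ⟨by simpa [Measure.restrict_eq_zero] using hpos⟩
    have hint : Integrable u (volume.restrict (cell m (cellIndex m x) : Set 𝔼)) :=
      (hu.restrict _).integrable (one_le_ofReal hp)
    have hx : (u - cellAverage m u) x = ⨍ y in cell m (cellIndex m x), (u x - u y) := by
      rw [setAverage_eq, integral_sub (integrable_const _) hint, smul_sub, ← setAverage_eq,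
        ← setAverage_eq, average_const]
      rfl
    rw [hx, ENNReal.ofReal_mul (by positivity), ENNReal.ofReal_pow (Nat.cast_nonneg _),
      ENNReal.ofReal_natCast, mul_assoc, ← lintegral_const_mul' _ _ ENNReal.ofReal_ne_top]
    refine (enorm_average_cell_rpow_le hm hp (aestronglyMeasurable_const.sub hu.1) _).trans ?_
    refine mul_le_mul_right ((setLIntegral_mono_ae' (measurableSet_cell m _)
      (ae_of_all _ fun y hy => ?_)).trans (setLIntegral_le_lintegral _ _)) _
    have hd := norm_sub_le_of_mem_cell hm (x := x) rfl hy
    change ‖u x - u y‖ₑ ^ p ≤ ENNReal.ofReal (R ^ (α * p)) * ‖diffQuot α u (x, y)‖ₑ ^ p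
    rw [enorm_rpow_eq_ofReal hp0, enorm_rpow_eq_ofReal hp0, ← ENNReal.ofReal_mul (by positivity),
      abs_diffQuot_rpow]
    apply ENNReal.ofReal_le_ofReal
    rw [abs_sub_comm]
    rcases eq_or_ne y x with rfl | h
    · simp [Real.zero_rpow hp0.ne']
    have hr : 0 < ‖y - x‖ := norm_pos_iff.2 (sub_ne_zero.2 h)
    simp only
    rw [mul_div_assoc', le_div_iff₀ (by positivity), mul_comm]
    gcongr
  rw [eLpNorm_ofReal_rpow hp0, eLpNorm_ofReal_rpow hp0]
  refine (lintegral_mono hpt).trans_eq ?_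
  rw [lintegral_const_mul' _ _ ENNReal.ofReal_ne_top, Measure.volume_eq_prod]
  rw [Measure.volume_eq_prod] at hDm
  rw [lintegral_prod _ hDm]

/-- The constant is a multiple of m^(n - αp): the condition αp > n makes cell averaging uniformly
accurate on bounded sets of the seminorm. -/
lemma tendsto_cell_constant {α p : ℝ} (hlow : (n : ℝ) < α * p) :
    Tendsto (fun m : ℕ => (m : ℝ) ^ n * (√n / m) ^ (α * p)) atTop (𝓝 0) := by
  have h := ((tendsto_rpow_neg_atTop (y := α * p - n) (by linarith)).comp
    tendsto_natCast_atTop_atTop).const_mul (√n ^ (α * p))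
  rw [mul_zero] at h
  refine h.congr' ?_
  filter_upwards [eventually_gt_atTop 0] with m hm
  have hm' : (0 : ℝ) < m := by exact_mod_cast hm
  simp only [Function.comp]
  rw [Real.div_rpow (by positivity) hm'.le, neg_sub, Real.rpow_sub hm', Real.rpow_natCast]
  ring

lemma cellAverage_eq_zero {m : ℕ} (hm : 0 < m) {D : Set 𝔼} {u : 𝔼 → ℝ}
    (h0 : ∀ x, x ∉ D → u x = 0) {x : 𝔼} (hx : x ∉ Metric.cthickening (√n / m) D) :
    cellAverage m u x = 0 := by
  rw [cellAverage, setAverage_eq, setIntegral_eq_zero_of_forall_eq_zero, smul_zero]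
  intro y hy
  refine h0 y fun hyD => hx ?_
  refine Metric.mem_cthickening_of_dist_le x y _ D hyD ?_
  rw [dist_eq_norm]
  exact norm_sub_le_of_mem_cell hm hy rfl

lemma abs_average_cell_le {m : ℕ} (hm : 0 < m) {p : ℝ} (hp : 1 ≤ p) {u : 𝔼 → ℝ}
    (hu : AEStronglyMeasurable u) (hN : eLpNorm u (ENNReal.ofReal p) ≤ 1) (j : Fin n → ℤ) :
    |⨍ y in cell m j, u y| ≤ (m : ℝ) ^ n := by
  have hp0 : 0 < p := by linarith
  have h1 : ‖⨍ y in cell m j, u y‖ₑ ^ p ≤ ((m : ℝ≥0∞) ^ n) ^ p := by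
    calc ‖⨍ y in cell m j, u y‖ₑ ^ p ≤ (m : ℝ≥0∞) ^ n * ∫⁻ y in cell m j, ‖u y‖ₑ ^ p :=
          enorm_average_cell_rpow_le hm hp hu j
      _ ≤ (m : ℝ≥0∞) ^ n * 1 := by
          gcongr
          refine (setLIntegral_le_lintegral _ _).trans ?_
          rw [← eLpNorm_ofReal_rpow hp0]
          exact ENNReal.rpow_le_one hN hp0.le
      _ ≤ ((m : ℝ≥0∞) ^ n) ^ p := by
          rw [mul_one]
          refine ENNReal.le_rpow_self_of_one_le (one_le_pow₀ ?_) hp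
          exact_mod_cast hm
  rw [ENNReal.rpow_le_rpow_iff hp0] at h1
  have h2 := ENNReal.toReal_mono (ENNReal.pow_ne_top (ENNReal.natCast_ne_top m)) h1
  simpa using h2

/-- All cell averages, at all scales, are bounded reals indexed by a countable set, so one
subsequence makes every one of them converge. At a fixed scale the averages then converge in `L^p`
by dominated convergence, being uniformly bounded and supported in a thickening of the bounded set
D. The averaging error is small uniformly in the sequence. -/
lemma exists_subseq_cauchy {α p : ℝ} (hα : 0 ≤ α) (hp : 1 ≤ p) (hlow : (n : ℝ) < α * p)
    {D : Set 𝔼} (hD : Bornology.IsBounded D) {φ : ℕ → 𝔼 → ℝ}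
    (hφ : ∀ k, AEStronglyMeasurable (φ k)) (h0 : ∀ k x, x ∉ D → φ k x = 0)
    (hN : ∀ k, eLpNorm (φ k) (ENNReal.ofReal p) ≤ 1) {M : ℝ≥0∞} (hM : M ≠ ⊤)
    (hG : ∀ k, eLpNorm (diffQuot α (φ k)) (ENNReal.ofReal p) ≤ M) :
    ∃ σ : ℕ → ℕ, StrictMono σ ∧ ∀ ε : ℝ≥0∞, 0 < ε → ∃ K, ∀ k ≥ K, ∀ l ≥ K,
      eLpNorm (φ (σ k) - φ (σ l)) (ENNReal.ofReal p) ≤ ε := by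
  have hp0 : 0 < p := by linarith
  have hP := one_le_ofReal hp
  -- The scale is shifted by one so that it is never zero.
  let b : ℕ → ℕ × (Fin n → ℤ) → ℝ := fun k i => ⨍ y in cell (i.1 + 1) i.2, φ k y
  have hb : ∀ k i, |b k i| ≤ ((i.1 + 1 : ℕ) : ℝ) ^ n := fun k i =>
    abs_average_cell_le i.1.succ_pos hp (hφ k) (hN k) i.2
  have hcomp : IsCompact (univ.pi fun i : ℕ × (Fin n → ℤ) =>
      Icc (-((i.1 + 1 : ℕ) : ℝ) ^ n) (((i.1 + 1 : ℕ) : ℝ) ^ n)) :=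
    isCompact_univ_pi fun i => isCompact_Icc
  obtain ⟨L, hL, σ, hσ, hlim⟩ := hcomp.tendsto_subseq (x := b) fun k i _ => abs_le.1 (hb k i)
  rw [tendsto_pi_nhds] at hlim
  refine ⟨σ, hσ, fun ε hε => ?_⟩
  -- A quarter of ε: each of the two functions is compared with the common limit ℓ through its cell
  -- average, giving four errors.
  obtain ⟨m, hm⟩ : ∃ m : ℕ, ENNReal.ofReal (((m + 1 : ℕ) : ℝ) ^ n * (√n / (m + 1 : ℕ)) ^ (α * p))
      * M ^ p ≤ (ε / 4) ^ p := by
    have h1 := (ENNReal.tendsto_ofReal (tendsto_cell_constant hlow)).comp (tendsto_add_atTop_nat 1)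
    have h2 := ENNReal.Tendsto.mul_const (b := M ^ p) h1
      (Or.inr (ENNReal.rpow_ne_top_of_nonneg hp0.le hM))
    rw [ENNReal.ofReal_zero, zero_mul] at h2
    have h3 : 0 < (ε / 4) ^ p := ENNReal.rpow_pos_of_nonneg
      (ENNReal.div_pos hε.ne' (by norm_num)) hp0.le
    exact ((h2.eventually (gt_mem_nhds h3)).exists).imp fun m hm => hm.le
  have hm1 : 0 < m + 1 := m.succ_pos
  have hmem : ∀ k, MemLp (φ k) (ENNReal.ofReal p) := fun k =>
    ⟨hφ k, (hN k).trans_lt ENNReal.one_lt_top⟩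
  have hA : ∀ k, eLpNorm (φ k - cellAverage (m + 1) (φ k)) (ENNReal.ofReal p) ≤ ε / 4 := by
    intro k
    rw [← ENNReal.rpow_le_rpow_iff hp0]
    refine (eLpNorm_sub_cellAverage_le hm1 hα hp (hmem k)).trans (le_trans ?_ hm)
    gcongr
    exact hG k
  set ℓ : 𝔼 → ℝ := fun x => L (m, cellIndex (m + 1) x)
  have hℓm : Measurable ℓ :=
    (measurable_of_countable fun j => L (m, j)).comp (measurable_cellIndex (m + 1))
  have hcm : ∀ k, Measurable (cellAverage (m + 1) (φ k)) := fun k =>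
    (measurable_of_countable fun j => b k (m, j)).comp (measurable_cellIndex (m + 1))
  have hpl : ∀ x, Tendsto (fun k => cellAverage (m + 1) (φ (σ k)) x) atTop (𝓝 (ℓ x)) :=
    fun x => hlim (m, cellIndex (m + 1) x)
  set T := Metric.cthickening (√n / (m + 1 : ℕ)) D
  have hTm : MeasurableSet T := Metric.isClosed_cthickening.measurableSet
  have hT : volume T < ⊤ := hD.cthickening.measure_lt_top
  set B : ℝ := ((m + 1 : ℕ) : ℝ) ^ n
  have hℓB : ∀ x, |ℓ x| ≤ B := fun x =>
    le_of_tendsto (hpl x).abs (Eventually.of_forall fun k => hb (σ k) (m, cellIndex (m + 1) x))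
  have hℓ0 : ∀ x, x ∉ T → ℓ x = 0 := fun x hx =>
    tendsto_nhds_unique (hpl x) (tendsto_const_nhds.congr fun k =>
      (cellAverage_eq_zero hm1 (h0 (σ k)) hx).symm)
  have hconv : Tendsto (fun k => eLpNorm (cellAverage (m + 1) (φ (σ k)) - ℓ) (ENNReal.ofReal p))
      atTop (𝓝 0) := by
    have hz := (ENNReal.continuous_rpow_const (y := p)).tendsto 0
    rw [ENNReal.zero_rpow_of_pos hp0] at hz
    have hd := tendsto_lintegral_of_dominated_convergence
      (F := fun k x => ‖(cellAverage (m + 1) (φ (σ k)) - ℓ) x‖ₑ ^ p) (f := fun _ : 𝔼 => 0)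
      (μ := volume) (T.indicator fun _ => ENNReal.ofReal ((2 * B) ^ p))
      (fun k => (((hcm _).sub hℓm).enorm).pow_const p)
      (fun k => ae_of_all _ fun x => by
        by_cases hx : x ∈ T
        · simp only [indicator_of_mem hx]
          rw [enorm_rpow_eq_ofReal hp0]
          apply ENNReal.ofReal_le_ofReal
          gcongr
          have h1 : |cellAverage (m + 1) (φ (σ k)) x| ≤ B := hb (σ k) (m, cellIndex (m + 1) x)
          refine (abs_sub _ _).trans ?_
          linarith [hℓB x]
        · simp only [Pi.sub_apply]
          rw [cellAverage_eq_zero hm1 (h0 (σ k)) hx, hℓ0 x hx]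
          simp [hp0])
      (by
        rw [lintegral_indicator_const hTm]
        exact ENNReal.mul_ne_top ENNReal.ofReal_ne_top hT.ne)
      (ae_of_all _ fun x => by
        have h1 : Tendsto (fun k => (cellAverage (m + 1) (φ (σ k)) - ℓ) x) atTop (𝓝 0) := by
          simpa using (hpl x).sub_const (ℓ x)
        have h2 : Tendsto (fun k => ‖(cellAverage (m + 1) (φ (σ k)) - ℓ) x‖ₑ) atTop (𝓝 0) := by
          simpa [Function.comp_def] using (continuous_enorm.tendsto (0 : ℝ)).comp h1
        exact hz.comp h2)
    rw [lintegral_zero] at hd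
    have h := (ENNReal.continuous_rpow_const (y := p⁻¹)).tendsto 0
    rw [ENNReal.zero_rpow_of_pos (inv_pos.2 hp0)] at h
    refine (h.comp hd).congr fun k => ?_
    simp only [Function.comp]
    rw [← eLpNorm_ofReal_rpow hp0, ENNReal.rpow_rpow_inv hp0.ne']
  have hε4 : 0 < ε / 4 := ENNReal.div_pos hε.ne' (by norm_num)
  obtain ⟨K, hK⟩ := eventually_atTop.1 (hconv.eventually (gt_mem_nhds hε4))
  have hhalf : ∀ k ≥ K, eLpNorm (φ (σ k) - ℓ) (ENNReal.ofReal p) ≤ ε / 4 + ε / 4 := by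
    intro k hk
    have h1 := eLpNorm_add_le (μ := volume) ((hφ (σ k)).sub (hcm (σ k)).aestronglyMeasurable)
      ((hcm (σ k)).aestronglyMeasurable.sub hℓm.aestronglyMeasurable) hP
    rw [sub_add_sub_cancel] at h1
    exact h1.trans (add_le_add (hA _) (hK k hk).le)
  refine ⟨K, fun k hk l hl => ?_⟩
  have h1 := eLpNorm_sub_le (μ := volume) ((hφ (σ k)).sub hℓm.aestronglyMeasurable)
    ((hφ (σ l)).sub hℓm.aestronglyMeasurable) hP
  rw [sub_sub_sub_cancel_right] at h1
  refine h1.trans ((add_le_add (hhalf k hk) (hhalf l hl)).trans_eq ?_)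
  have : ε = 4 * (ε / 4) := (ENNReal.mul_div_cancel (by norm_num) (by norm_num)).symm
  conv_rhs => rw [this]
  ring

lemma exists_tendsto_of_cauchy {X : Type*} [MeasurableSpace X] {μ : Measure X} {P : ℝ≥0∞}
    (hP : 1 ≤ P) {f : ℕ → X → ℝ} (hf : ∀ k, MemLp (f k) P μ)
    (hc : ∀ ε : ℝ≥0∞, 0 < ε → ∃ K, ∀ k ≥ K, ∀ l ≥ K, eLpNorm (f k - f l) P μ ≤ ε) :
    ∃ u, MemLp u P μ ∧ Tendsto (fun k => eLpNorm (f k - u) P μ) atTop (𝓝 0) := by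
  have : Fact (1 ≤ P) := ⟨hP⟩
  have hcs : CauchySeq fun k => (hf k).toLp (f k) := by
    rw [EMetric.cauchySeq_iff]
    intro ε hε
    obtain ⟨δ, hδ, hδε⟩ := exists_between hε
    obtain ⟨K, hK⟩ := hc δ hδ
    refine ⟨K, fun k hk l hl => ?_⟩
    rw [Lp.edist_toLp_toLp]
    exact (hK k hk l hl).trans_lt hδε
  obtain ⟨g, hg⟩ := cauchySeq_tendsto_of_complete hcs
  refine ⟨g, Lp.memLp g, ?_⟩
  rw [← Lp.tendsto_Lp_iff_tendsto_eLpNorm'' f hf g (Lp.memLp g), Lp.toLp_coeFn]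
  exact hg

/-! ### Existence of a minimizer -/

/-- The map a ↦ √(a² + δ²) is the Euclidean norm of (a, δ), hence 1-Lipschitz. So the smooth
substitute for |φ| does not raise the seminorm. -/
lemma abs_sqrt_sub_sqrt_le (a b δ : ℝ) :
    |√(a ^ 2 + δ ^ 2) - √(b ^ 2 + δ ^ 2)| ≤ |a - b| := by
  have key : ∀ a b : ℝ, √(a ^ 2 + δ ^ 2) - √(b ^ 2 + δ ^ 2) ≤ |a - b| := by
    intro a b
    rw [sub_le_iff_le_add']
    have hs := Real.sq_sqrt (show 0 ≤ b ^ 2 + δ ^ 2 by positivity)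
    have hb : |b| ≤ √(b ^ 2 + δ ^ 2) := by
      rw [← Real.sqrt_sq_eq_abs]
      exact Real.sqrt_le_sqrt (by nlinarith [sq_nonneg δ])
    refine Real.sqrt_le_iff.2 ⟨by positivity, ?_⟩
    have h1 : b * (a - b) ≤ √(b ^ 2 + δ ^ 2) * |a - b| :=
      (le_abs_self _).trans ((abs_mul _ _).trans_le (by gcongr))
    nlinarith [sq_abs (a - b)]
  exact abs_le.2 ⟨by rw [neg_le, neg_sub, abs_sub_comm]; exact key b a, key a b⟩

lemma eLpNorm_diffQuot_mono {α : ℝ} {P : ℝ≥0∞} {f g : 𝔼 → ℝ}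
    (h : ∀ x y, |f y - f x| ≤ |g y - g x|) :
    eLpNorm (diffQuot α f) P ≤ eLpNorm (diffQuot α g) P := by
  refine eLpNorm_mono fun z => ?_
  rw [Real.norm_eq_abs, Real.norm_eq_abs, abs_diffQuot, abs_diffQuot]
  exact div_le_div_of_nonneg_right (h _ _) (by positivity)

/-- A smooth, nonnegative approximation of `|φ|`. -/
lemma IsTestFunction.sqrt_sq_add_sq_sub {D : Set 𝔼} {φ : 𝔼 → ℝ} (hφ : IsTestFunction D φ) {δ : ℝ}
    (hδ : 0 < δ) : IsTestFunction D fun x => √(φ x ^ 2 + δ ^ 2) - δ := by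
  have hsup : tsupport (fun x => √(φ x ^ 2 + δ ^ 2) - δ) ⊆ tsupport φ := by
    refine closure_mono fun x hx => ?_
    rw [Function.mem_support] at hx ⊢
    intro h
    simp [h, Real.sqrt_sq hδ.le] at hx
  refine ⟨?_, hφ.2.1.of_isClosed_subset (isClosed_tsupport _) hsup, hsup.trans hφ.2.2⟩
  refine ContDiff.sub (ContDiff.sqrt ?_ fun x => by positivity) contDiff_const
  exact (hφ.1.pow 2).add contDiff_const

/-- Start from a test function with quotient below c and replace it by a smoothed absolute value.
The seminorm does not grow and the `L^p` norm is recovered as δ → 0, so the strict inequality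
survives for some δ; homogeneity then normalizes. -/
lemma exists_nonneg_testFunction {α p : ℝ} (hp : 1 ≤ p) {D : Set 𝔼} {c : ℝ≥0∞}
    (hc : firstEigenvalue α p D < c) (hct : c ≠ ⊤) :
    ∃ ψ, IsTestFunction D ψ ∧ (∀ x, 0 ≤ ψ x) ∧ eLpNorm ψ (ENNReal.ofReal p) = 1 ∧
      eLpNorm (diffQuot α ψ) (ENNReal.ofReal p) ^ p ≤ c := by
  have hp0 : 0 < p := by linarith
  have hc0 : c ≠ 0 := (zero_le.trans_lt hc).ne'
  simp only [firstEigenvalue, iInf_lt_iff] at hc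
  obtain ⟨φ, hφ, hne, hR⟩ := hc
  have hφN := (hφ.memLp (ENNReal.ofReal p)).2
  rw [← not_le, le_rayleighQuotient_iff hp0 hφ.aestronglyMeasurable hφN (hφ.not_ae_zero hne)] at hR
  have hcp0 : c ^ (1 / p) ≠ 0 := by simp [ENNReal.rpow_eq_zero_iff, hc0, hct]
  have hcpt : c ^ (1 / p) ≠ ⊤ := ENNReal.rpow_ne_top_of_nonneg (by positivity) hct
  let δ : ℕ → ℝ := fun k => 1 / (k + 1)
  have hδ : ∀ k, 0 < δ k := fun k => by positivity
  let ψ : ℕ → 𝔼 → ℝ := fun k x => √(φ x ^ 2 + δ k ^ 2) - δ k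
  have hψ : ∀ k, IsTestFunction D (ψ k) := fun k => hφ.sqrt_sq_add_sq_sub (hδ k)
  have hψG : ∀ k, eLpNorm (diffQuot α (ψ k)) (ENNReal.ofReal p) ≤
      eLpNorm (diffQuot α φ) (ENNReal.ofReal p) := fun k => eLpNorm_diffQuot_mono fun x y => by
    simp only [ψ, sub_sub_sub_cancel_right]
    exact abs_sqrt_sub_sqrt_le _ _ _
  obtain ⟨k, hk⟩ : ∃ k, eLpNorm (diffQuot α (ψ k)) (ENNReal.ofReal p) <
      c ^ (1 / p) * eLpNorm (ψ k) (ENNReal.ofReal p) := by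
    -- If every δ failed, Fatou would carry the bound on the norms of ψ k over to |φ|, contradicting
    -- the strict inequality for φ.
    by_contra! h
    apply hR
    have habs : eLpNorm φ (ENNReal.ofReal p) = eLpNorm (fun x => |φ x|) (ENNReal.ofReal p) :=
      (eLpNorm_norm φ).symm
    rw [habs, mul_comm, ← ENNReal.le_div_iff_mul_le (Or.inl hcp0) (Or.inl hcpt)]
    refine Lp.eLpNorm_le_of_ae_tendsto (u := atTop) (f := ψ) (Eventually.of_forall fun k => ?_)
      (fun k => (hψ k).aestronglyMeasurable) (ae_of_all _ fun x => ?_)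
    · rw [ENNReal.le_div_iff_mul_le (Or.inl hcp0) (Or.inl hcpt), mul_comm]
      exact (h k).trans (hψG k)
    · have hcont : Continuous fun t : ℝ => √(φ x ^ 2 + t ^ 2) - t := by fun_prop
      have := (hcont.tendsto 0).comp (tendsto_one_div_add_atTop_nhds_zero_nat (𝕜 := ℝ))
      simpa [Real.sqrt_sq_eq_abs, Function.comp_def, ψ, δ] using this
  set N := eLpNorm (ψ k) (ENNReal.ofReal p)
  have hN0 : N ≠ 0 := fun h => by simp [h] at hk
  have hNt : N ≠ ⊤ := ((hψ k).memLp (ENNReal.ofReal p)).2.ne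
  have hen : ‖(N.toReal)⁻¹‖ₑ = N⁻¹ := by
    rw [enorm_inv (ENNReal.toReal_ne_zero.2 ⟨hN0, hNt⟩), Real.enorm_toReal hNt]
  refine ⟨(N.toReal)⁻¹ • ψ k, (hψ k).const_smul _, fun x => ?_, ?_, ?_⟩
  · have h1 : δ k ≤ √(φ x ^ 2 + δ k ^ 2) := by
      apply Real.le_sqrt_of_sq_le
      nlinarith [sq_nonneg (φ x)]
    exact mul_nonneg (inv_nonneg.2 ENNReal.toReal_nonneg) (sub_nonneg.2 h1)
  · rw [eLpNorm_const_smul, hen, ENNReal.inv_mul_cancel hN0 hNt]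
  · have h1 : N⁻¹ * eLpNorm (diffQuot α (ψ k)) (ENNReal.ofReal p) ≤ c ^ (1 / p) := by
      rw [mul_comm, ← div_eq_mul_inv]
      exact ENNReal.div_le_of_le_mul hk.le
    rw [diffQuot_smul, eLpNorm_const_smul, hen]
    refine (ENNReal.rpow_le_rpow h1 hp0.le).trans_eq ?_
    rw [← ENNReal.rpow_mul, one_div_mul_cancel hp0.ne', ENNReal.rpow_one]

/-- Clarkson's inequality for real numbers. -/
lemma abs_add_rpow_add_abs_sub_rpow_le {p : ℝ} (hp : 2 ≤ p) (a b : ℝ) :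
    |a + b| ^ p + |a - b| ^ p ≤ 2 ^ (p - 1) * (|a| ^ p + |b| ^ p) := by
  have hsq : ∀ t : ℝ, |t| ^ p = (t ^ 2) ^ (p / 2) := fun t => by
    rw [← sq_abs, ← Real.rpow_natCast, ← Real.rpow_mul (abs_nonneg t)]
    congr 1
    push_cast
    ring
  have hq : 1 ≤ p / 2 := by linarith
  simp only [hsq]
  -- Superadditivity of t ↦ t^(p/2) bounds the sum of the two powers by the power of the sum; the
  -- parallelogram law and convexity of the same function do the rest.
  have h1 := Real.add_rpow_le_rpow_add (sq_nonneg (a + b)) (sq_nonneg (a - b)) hq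
  have h2 : (a ^ 2 + b ^ 2) ^ (p / 2) ≤
      2 ^ (p / 2 - 1) * ((a ^ 2) ^ (p / 2) + (b ^ 2) ^ (p / 2)) := by
    have := NNReal.rpow_add_le_mul_rpow_add_rpow ⟨a ^ 2, sq_nonneg a⟩ ⟨b ^ 2, sq_nonneg b⟩ hq
    exact_mod_cast this
  refine h1.trans ?_
  have h3 : (a + b) ^ 2 + (a - b) ^ 2 = 2 * (a ^ 2 + b ^ 2) := by ring
  rw [h3, Real.mul_rpow (by norm_num) (by positivity)]
  calc (2 : ℝ) ^ (p / 2) * (a ^ 2 + b ^ 2) ^ (p / 2)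
      ≤ 2 ^ (p / 2) * (2 ^ (p / 2 - 1) * ((a ^ 2) ^ (p / 2) + (b ^ 2) ^ (p / 2))) := by gcongr
    _ = _ := by
      rw [← mul_assoc, ← Real.rpow_add (by norm_num)]
      ring_nf

lemma eLpNorm_add_rpow_add_eLpNorm_sub_rpow_le {X : Type*} [MeasurableSpace X] {μ : Measure X}
    {p : ℝ} (hp : 2 ≤ p) {f g : X → ℝ} (hf : AEStronglyMeasurable f μ)
    (hg : AEStronglyMeasurable g μ) :
    eLpNorm (f + g) (ENNReal.ofReal p) μ ^ p + eLpNorm (f - g) (ENNReal.ofReal p) μ ^ p ≤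
      ENNReal.ofReal (2 ^ (p - 1)) *
        (eLpNorm f (ENNReal.ofReal p) μ ^ p + eLpNorm g (ENNReal.ofReal p) μ ^ p) := by
  have hp0 : 0 < p := by linarith
  simp only [eLpNorm_ofReal_rpow hp0]
  rw [← lintegral_add_left' ((hf.add hg).enorm.pow_const p),
    ← lintegral_add_left' (hf.enorm.pow_const p), ← lintegral_const_mul' _ _ ENNReal.ofReal_ne_top]
  refine lintegral_mono fun x => ?_
  simp only [enorm_rpow_eq_ofReal hp0, Pi.add_apply, Pi.sub_apply]
  rw [← ENNReal.ofReal_add (by positivity) (by positivity),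
    ← ENNReal.ofReal_add (by positivity) (by positivity), ← ENNReal.ofReal_mul (by positivity)]
  exact ENNReal.ofReal_le_ofReal (abs_add_rpow_add_abs_sub_rpow_le hp _ _)

/-- An `L^p`-Cauchy minimizing sequence is Cauchy in the Gagliardo seminorm. -/
lemma cauchy_diffQuot_of_minimizing {α p : ℝ} (hp : 2 ≤ p) {D : Set 𝔼}
    (hfin : firstEigenvalue α p D ≠ ⊤) {f : ℕ → 𝔼 → ℝ} (hf : ∀ k, IsTestFunction D (f k))
    (hN : ∀ k, eLpNorm (f k) (ENNReal.ofReal p) = 1)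
    (hG : ∀ c, firstEigenvalue α p D < c →
      ∀ᶠ k in atTop, eLpNorm (diffQuot α (f k)) (ENNReal.ofReal p) ^ p ≤ c)
    (hc : ∀ ε : ℝ≥0∞, 0 < ε → ∃ K, ∀ k ≥ K, ∀ l ≥ K,
      eLpNorm (f k - f l) (ENNReal.ofReal p) ≤ ε) (ε : ℝ≥0∞) (hε : 0 < ε) :
    ∃ K, ∀ k ≥ K, ∀ l ≥ K, eLpNorm (diffQuot α (f k - f l)) (ENNReal.ofReal p) ≤ ε := by
  have hp0 : 0 < p := by linarith
  have hP := one_le_ofReal (show 1 ≤ p by linarith)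
  wlog hεt : ε ≠ ⊤ generalizing ε
  · exact ⟨0, fun k _ l _ => by rw [not_not.1 hεt]; exact le_top⟩
  set L := (firstEigenvalue α p D).toReal
  have hL : firstEigenvalue α p D = ENNReal.ofReal L := (ENNReal.ofReal_toReal hfin).symm
  have hL0 : 0 ≤ L := ENNReal.toReal_nonneg
  have hε' : 0 < ε.toReal ^ p := Real.rpow_pos_of_pos (ENNReal.toReal_pos hε.ne' hεt) _
  -- The expression is Clarkson's bound for [f k - f l]^p when both energies are at most L + δ and
  -- ‖f k + f l‖ ≥ 2 - δ. It is continuous in δ and vanishes at δ = 0.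
  obtain ⟨δ, hδ0, hδ1, hδ⟩ : ∃ δ : ℝ, 0 < δ ∧ δ < 1 ∧
      2 ^ (p - 1) * ((L + δ) + (L + δ)) - L * (2 - δ) ^ p < ε.toReal ^ p := by
    have hcont : Continuous fun δ : ℝ =>
        2 ^ (p - 1) * ((L + δ) + (L + δ)) - L * (2 - δ) ^ p := by
      have : Continuous fun δ : ℝ => (2 - δ) ^ p :=
        (Real.continuous_rpow_const hp0.le).comp (by fun_prop)
      fun_prop
    have h0 : (2 : ℝ) ^ (p - 1) * ((L + 0) + (L + 0)) - L * (2 - 0) ^ p = 0 := by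
      rw [Real.rpow_sub_one (by norm_num)]; ring_nf
    have ht := (hcont.tendsto 0).mono_left (nhdsWithin_le_nhds (s := Ioi 0))
    rw [h0] at ht
    have h1 : ∀ᶠ δ : ℝ in 𝓝[>] 0, δ < 1 := nhdsWithin_le_nhds (gt_mem_nhds one_pos)
    obtain ⟨δ, ⟨h2, h3⟩, h4⟩ :=
      ((ht.eventually (gt_mem_nhds hε')).and h1 |>.and self_mem_nhdsWithin).exists
    exact ⟨δ, h4, h3, h2⟩
  obtain ⟨K₁, hK₁⟩ := eventually_atTop.1 (hG (ENNReal.ofReal (L + δ)) (by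
    rw [hL]; exact (ENNReal.ofReal_lt_ofReal_iff (by positivity)).2 (by linarith)))
  obtain ⟨K₂, hK₂⟩ := hc (ENNReal.ofReal δ) (by simpa using hδ0)
  refine ⟨max K₁ K₂, fun k hk l hl => ?_⟩
  have hGk := hK₁ k ((le_max_left _ _).trans hk)
  have hGl := hK₁ l ((le_max_left _ _).trans hl)
  have hkl := hK₂ k ((le_max_right _ _).trans hk) l ((le_max_right _ _).trans hl)
  have hm : ∀ k, AEStronglyMeasurable (f k) := fun k => (hf k).aestronglyMeasurable
  have hDm := fun k => aestronglyMeasurable_diffQuot_univ α (hm k)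
  -- From 2 f k = (f k + f l) + (f k - f l) with ‖f k‖ = 1 and ‖f k - f l‖ ≤ δ. The Poincaré
  -- inequality then bounds the energy of f k + f l below, as Clarkson's inequality requires.
  have hNs : ENNReal.ofReal (2 - δ) ≤ eLpNorm (f k + f l) (ENNReal.ofReal p) := by
    have h1 : (2 : ℝ) • f k = (f k + f l) + (f k - f l) := by
      ext x; simp only [Pi.smul_apply, smul_eq_mul, Pi.add_apply, Pi.sub_apply]; ring
    have h2 := eLpNorm_add_le ((hm k).add (hm l)) ((hm k).sub (hm l)) hP
    rw [← h1, eLpNorm_const_smul, hN, mul_one] at h2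
    have h3 : ‖(2 : ℝ)‖ₑ = ENNReal.ofReal 2 := Real.enorm_eq_ofReal (by norm_num)
    rw [ENNReal.ofReal_sub _ hδ0.le, ← h3]
    exact tsub_le_iff_right.2 (h2.trans (add_le_add le_rfl hkl))
  have hlow : ENNReal.ofReal (L * (2 - δ) ^ p) ≤
      eLpNorm (diffQuot α (f k) + diffQuot α (f l)) (ENNReal.ofReal p) ^ p := by
    have h1 := ENNReal.rpow_le_rpow
      (firstEigenvalue_mul_le (α := α) (p := p) hp0 ((hf k).add (hf l))) hp0.le
    rw [ENNReal.mul_rpow_of_nonneg _ _ hp0.le, ← ENNReal.rpow_mul, one_div_mul_cancel hp0.ne',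
      ENNReal.rpow_one, diffQuot_add] at h1
    refine le_trans ?_ h1
    rw [ENNReal.ofReal_mul hL0, ← hL, ← ENNReal.ofReal_rpow_of_nonneg (by linarith) hp0.le]
    gcongr
  have hcl := eLpNorm_add_rpow_add_eLpNorm_sub_rpow_le hp (hDm k) (hDm l)
  have hup := hcl.trans (mul_le_mul_right (add_le_add hGk hGl) _)
  rw [← ENNReal.ofReal_add (by positivity) (by positivity),
    ← ENNReal.ofReal_mul (by positivity), ← diffQuot_sub] at hup
  have h2 := (add_le_add hlow le_rfl).trans hup
  have h3 : eLpNorm (diffQuot α (f k - f l)) (ENNReal.ofReal p) ^ p ≤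
      ENNReal.ofReal (2 ^ (p - 1) * ((L + δ) + (L + δ)) - L * (2 - δ) ^ p) := by
    rw [ENNReal.ofReal_sub _ (mul_nonneg hL0 (Real.rpow_nonneg (by linarith) _))]
    exact ENNReal.le_sub_of_add_le_left ENNReal.ofReal_ne_top h2
  rw [← ENNReal.rpow_le_rpow_iff hp0]
  refine h3.trans ((ENNReal.ofReal_le_ofReal hδ.le).trans_eq ?_)
  rw [← ENNReal.ofReal_rpow_of_nonneg ENNReal.toReal_nonneg hp0.le, ENNReal.ofReal_toReal hεt]

/-- Strong convergence in both norms is needed, since membership in W₀^{s,p} asks for approximation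
in norm by test functions; the minimizing sequence itself supplies them. -/
lemma exists_nonneg_isRayleighMinimizer {α p : ℝ} (hp : 2 ≤ p)
    (hlow : (n : ℝ) < α * p) {D : Set 𝔼} (hD : IsOpen D) (hDb : Bornology.IsBounded D)
    (hfin : firstEigenvalue α p D ≠ ⊤) :
    ∃ u : 𝔼 → ℝ, IsRayleighMinimizer α p D u ∧ (∀ x, 0 ≤ u x) ∧ ∀ x, x ∉ D → u x = 0 := by
  have hp0 : 0 < p := by linarith
  have hp1 : 1 ≤ p := by linarith
  have hP := one_le_ofReal hp1
  have hα : 0 ≤ α := (pos_of_mul_pos_left ((Nat.cast_nonneg n).trans_lt hlow) hp0.le).le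
  set lam := firstEigenvalue α p D
  have hinv : ∀ k : ℕ, ((k : ℝ≥0∞) + 1)⁻¹ ≤ 1 := fun k => by simp
  have hlim : Tendsto (fun k : ℕ => lam + ((k : ℝ≥0∞) + 1)⁻¹) atTop (𝓝 lam) := by
    have := (ENNReal.tendsto_inv_nat_nhds_zero.comp (tendsto_add_atTop_nat 1)).const_add lam
    rw [add_zero] at this
    exact this.congr fun k => by simp
  choose ψ hψ hψ0 hψN hψG using fun k : ℕ => exists_nonneg_testFunction (α := α) hp1 (D := D)
    (c := lam + ((k : ℝ≥0∞) + 1)⁻¹) (ENNReal.lt_add_right hfin (by simp))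
    (ENNReal.add_ne_top.2 ⟨hfin, by simp⟩)
  obtain ⟨σ, hσ, hcau⟩ := exists_subseq_cauchy hα hp1 hlow hDb (fun k => (hψ k).aestronglyMeasurable)
    (fun k => (hψ k).eq_zero) (fun k => (hψN k).le) (M := (lam + 1) ^ (1 / p))
    (ENNReal.rpow_ne_top_of_nonneg (by positivity) (ENNReal.add_ne_top.2 ⟨hfin, by simp⟩))
    (fun k => by
      rw [one_div, ENNReal.le_rpow_inv_iff hp0]
      exact (hψG k).trans (add_le_add le_rfl (hinv k)))
  set f : ℕ → 𝔼 → ℝ := fun k => ψ (σ k)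
  have hf : ∀ k, IsTestFunction D (f k) := fun k => hψ (σ k)
  have hfm : ∀ k, AEStronglyMeasurable (f k) := fun k => (hf k).aestronglyMeasurable
  have hfG : ∀ c, lam < c →
      ∀ᶠ k in atTop, eLpNorm (diffQuot α (f k)) (ENNReal.ofReal p) ^ p ≤ c := fun c hc => by
    filter_upwards [(hlim.comp hσ.tendsto_atTop).eventually (gt_mem_nhds hc)] with k hk
    exact (hψG (σ k)).trans hk.le
  have hcauG := cauchy_diffQuot_of_minimizing hp hfin hf (fun k => hψN (σ k)) hfG hcau
  obtain ⟨w, hw, hwlim⟩ := exists_tendsto_of_cauchy hP (fun k => (hf k).memLp _) hcau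
  obtain ⟨τ, hτ, hτae⟩ := (tendstoInMeasure_of_tendsto_eLpNorm (by simpa using hp0) hfm hw.1
    hwlim).exists_seq_tendsto_ae
  -- The `L^p` limit is defined only up to null sets; this representative is nonnegative and zero
  -- off D at every point. It equals w almost everywhere, as w is an almost everywhere limit of
  -- nonnegative functions vanishing off D.
  set u : 𝔼 → ℝ := D.indicator fun x => max (w x) 0
  have hu0 : ∀ x, x ∉ D → u x = 0 := fun x hx => indicator_of_notMem hx _
  have hunn : ∀ x, 0 ≤ u x := fun x => indicator_nonneg (fun _ _ => le_max_right _ _) x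
  have hwu : w =ᵐ[volume] u := by
    filter_upwards [hτae] with x hx
    by_cases hxD : x ∈ D
    · have : 0 ≤ w x := ge_of_tendsto hx (Eventually.of_forall fun k => hψ0 _ x)
      simp [u, hxD, this]
    · rw [hu0 x hxD]
      exact tendsto_nhds_unique hx
        (tendsto_const_nhds.congr fun k => ((hf (τ k)).eq_zero x hxD).symm)
  have hum : AEStronglyMeasurable u := hw.1.congr hwu
  have huN : eLpNorm u (ENNReal.ofReal p) < ⊤ := by rw [← eLpNorm_congr_ae hwu]; exact hw.2
  have hulim : Tendsto (fun k => eLpNorm (u - f k) (ENNReal.ofReal p)) atTop (𝓝 0) := by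
    refine hwlim.congr fun k => ?_
    rw [eLpNorm_sub_comm]
    exact eLpNorm_congr_ae (hwu.sub EventuallyEq.rfl)
  have huae : ∀ᵐ x, Tendsto (fun k => f (τ k) x) atTop (𝓝 (u x)) := by
    filter_upwards [hτae, hwu] with x h1 h2
    rwa [← h2]
  have hDae : ∀ᵐ z : 𝔼 × 𝔼, Tendsto (fun k => diffQuot α (f (τ k)) z) atTop
      (𝓝 (diffQuot α u z)) := by
    have h := ae_diffQuot_tendsto_zero α (e := fun k => f (τ k) - u) (by
      filter_upwards [huae] with x hx
      simpa using hx.sub_const (u x))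
    filter_upwards [h] with z hz
    simp only [diffQuot_sub] at hz
    simpa using hz.add_const (diffQuot α u z)
  have huG : eLpNorm (diffQuot α u) (ENNReal.ofReal p) ^ p ≤ lam := by
    refine le_of_forall_gt_imp_ge_of_dense fun c hc => ?_
    rw [← ENNReal.le_rpow_inv_iff hp0]
    refine Lp.eLpNorm_le_of_ae_tendsto (u := atTop) ?_
      (fun k => aestronglyMeasurable_diffQuot_univ α (hfm (τ k))) hDae
    filter_upwards [hτ.tendsto_atTop.eventually (hfG c hc)] with k hk
    rwa [ENNReal.le_rpow_inv_iff hp0]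
  -- Fatou in the second index turns the Cauchy property of the seminorms into convergence to u.
  have huGlim : Tendsto (fun k => eLpNorm (diffQuot α (u - f k)) (ENNReal.ofReal p))
      atTop (𝓝 0) := by
    rw [ENNReal.tendsto_nhds_zero]
    intro ε hε
    obtain ⟨K, hK⟩ := hcauG ε hε
    filter_upwards [eventually_ge_atTop K] with k hk
    refine Lp.eLpNorm_le_of_ae_tendsto (u := atTop) (f := fun l => diffQuot α (f (τ l) - f k)) ?_
      (fun l => aestronglyMeasurable_diffQuot_univ α ((hfm (τ l)).sub (hfm k))) ?_
    · filter_upwards [hτ.tendsto_atTop.eventually (eventually_ge_atTop K)] with l hl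
      exact hK _ hl _ hk
    · filter_upwards [hDae] with z hz
      simp only [diffQuot_sub]
      exact hz.sub_const _
  -- Only this lower bound on the norm is needed: with [u]^p ≤ λ₁ it gives R(u) ≤ λ₁ and excludes u
  -- = 0.
  have hu1 : 1 ≤ eLpNorm u (ENNReal.ofReal p) := by
    have h := hulim.const_add (eLpNorm u (ENNReal.ofReal p))
    rw [add_zero] at h
    refine ge_of_tendsto h (Eventually.of_forall fun k => ?_)
    have := eLpNorm_sub_le hum (hum.sub (hfm k)) hP
    rwa [sub_sub_cancel, hψN (σ k)] at this
  have hmem : u ∈ fracSobolevZero (α - n / p) p D := by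
    refine mem_fracSobolevZero_of_tendsto hp1 hum hu0 huN ?_ hf hulim ?_
    · refine (eLpNorm_mono_measure _ Measure.restrict_le_self).trans_lt ?_
      rw [← ENNReal.rpow_lt_top_iff_of_pos hp0]
      exact huG.trans_lt hfin.lt_top
    · exact tendsto_of_tendsto_of_tendsto_of_le_of_le tendsto_const_nhds huGlim
        (fun _ => zero_le) fun k => eLpNorm_mono_measure _ Measure.restrict_le_self
  refine ⟨u, ⟨hmem, fun h => ?_, fun v hv hv0 => ?_⟩, hunn, hu0⟩
  · rw [eLpNorm_congr_ae h, eLpNorm_zero] at hu1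
    exact absurd hu1 (by simp)
  · refine le_trans ?_ (firstEigenvalue_le_rayleighQuotient hp1 hD hfin hv hv0)
    rw [rayleighQuotient_eq hp0 hum]
    refine ENNReal.div_le_of_le_mul (huG.trans ?_)
    exact le_mul_of_one_le_right' (ENNReal.one_le_rpow hu1 hp0)

end FractionalRayleigh

theorem mainTheorem12 (n : ℕ) (hn : 1 ≤ n) (α p : ℝ) (hp : 2 ≤ p)
    (hlow : (n : ℝ) < α * p) (hupp : α * p < n + p)
    (Ω : Set (EuclideanSpace ℝ (Fin n))) (hΩo : IsOpen Ω) (hΩc : IsConnected Ω)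
    (hΩb : Bornology.IsBounded Ω) :
    firstEigenvalue α p Ω ≠ ⊤ ∧
    (∃ u : EuclideanSpace ℝ (Fin n) → ℝ,
      IsRayleighMinimizer α p Ω u ∧ (∀ x, 0 ≤ u x) ∧ (∀ x, x ∉ Ω → u x = 0)) ∧
    (∀ u : EuclideanSpace ℝ (Fin n) → ℝ, IsRayleighMinimizer α p Ω u →
      rayleighQuotient α p u = firstEigenvalue α p Ω ∧
      SatisfiesEulerLagrange α p Ω (firstEigenvalue α p Ω).toReal u ∧
      (2 * (n : ℝ) < α * p →
        ∃ v : EuclideanSpace ℝ (Fin n) → ℝ, v =ᵐ[volume] u ∧ (∀ x, x ∉ Ω → v x = 0) ∧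
          MemHolderSpace (α - 2 * n / p) v)) := by
  have hp0 : 0 < p := by linarith
  have hp1 : 1 ≤ p := by linarith
  have hfin := firstEigenvalue_ne_top hn hp1 hlow hupp hΩo hΩc.nonempty
  refine ⟨hfin, exists_nonneg_isRayleighMinimizer hp hlow hΩo hΩb hfin, fun u hu => ?_⟩
  refine ⟨hu.rayleighQuotient_eq hn hp1 hlow hupp hΩo hfin,
    hu.satisfiesEulerLagrange hn hp hlow hupp hΩo hfin, fun h2 => ?_⟩
  refine exists_memHolderSpace hn hp1 h2 hΩo hΩb hu.1 ?_
  exact hu.eLpNorm_diffQuot_lt_top hn hp1 hlow hupp hΩo hfin
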